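/- Let $D\subset\mathbb C$ be a domain of class $C^4$ (every boundary point has a neighbourhood $U$ with a $C^4$ function $\phi:U\to\mathbb R$ without critical points such that $D\cap U=\{z\in U:\phi(z)<0\}$). Let $p\in bD$, let $\phi$ be any such defining function near $p$, let $e^{i\theta}=\nabla\phi(p)/\|\nabla\phi(p)\|$ be the outward unit normal at $p$, and let $$\kappa_p=\frac{H_\phi(p)(i\nabla\phi(p))}{\|\nabla\phi(p)\|^3}$$ be the curvature of $bD$ at $p$, where $H_\phi(p)$ is the real Hessian quadratic form of $\phi$. For $\eta,\nu>0$ put $$C_{\eta,\nu}(p)=\{z\in\mathbb C:\ |\mathrm{Im}(e^{-i\theta}(z-p))|<\eta\,\mathrm{Re}(e^{-i\theta}(z-p))^2,\ -\nu<\mathrm{Re}(e^{-i\theta}(z-p))<0\}.$$ A family of metrics $F_\Omega(z,\xi)$, with $F_\Omega(z,\xi)\ge 0$ and $F_\Omega(z,c\xi)=|c|F_\Omega(z,\xi)$, defined for all domains $\Omega\subset\mathbb C$, $z\in\Omega$ and $\xi\in\mathbb C$, is called invariant if on the unit disk $\triangle$ it equals both the Kobayashi and the Carathéodory metric (which coincide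 there), and if $F_{\Omega_2}(g(z),g'(z)\xi)\le F_{\Omega_1}(z,\xi)$ for every holomorphic $g:\Omega_1\to\Omega_2$; write $F_\Omega(z)=F_\Omega(z,1)$. Then for every $\eta>0$ there are $\nu>0$ and a constant $C$ such that $C_{\eta,\nu}(p)\subset D$ and, for every $z\in C_{\eta,\nu}(p)$, $$\Bigl|F_D(z)-\frac{1}{2|z-p|}-\frac{\kappa_p}{4}\Bigr|\le C|z-p|$$ for every invariant metric $F$. Moreover the Bergman kernel $B_D$ of $D$ (the reproducing kernel of the space of holomorphic functions on $D$ that are square integrable with respect to Lebesgue measure) exists, and the same estimate holds with $F_D(z)$ replaced by $\sqrt{\pi B_D(z,z)}$, the density obtained from the Bergman kernel on the diagonal, normalised to equal $1/(1-|z|^2)$ on the unit disk. -/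

import Mathlib

/-- A planar domain: a nonempty connected open subset of the complex plane. -/
def IsPlanarDomain (D : Set ℂ) : Prop :=
  IsOpen D ∧ IsConnected D

/-- `φ` is a defining function of class `C^k` for `D` on the neighbourhood `U` of `p`. -/
structure IsLocalDefiningFunction (k : ℕ) (D : Set ℂ) (p : ℂ) (U : Set ℂ) (φ : ℂ → ℝ) :
    Prop where
  isOpen : IsOpen U
  mem : p ∈ U
  contDiffOn : ContDiffOn ℝ k φ U
  gradient_ne_zero : ∀ z ∈ U, gradient φ z ≠ 0
  inter_eq : D ∩ U = {z ∈ U | φ z < 0}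

/-- A planar domain of class `C^k`: near each boundary point it is the set where a
`C^k` function without critical points is negative. -/
def IsPlanarDomainOfClass (k : ℕ) (D : Set ℂ) : Prop :=
  IsPlanarDomain D ∧
    ∀ p ∈ frontier D, ∃ (U : Set ℂ) (φ : ℂ → ℝ), IsLocalDefiningFunction k D p U φ

/-- The real Hessian of `φ` at `p`, as a quadratic form on `ℂ = ℝ²`. -/
noncomputable def realHessian (φ : ℂ → ℝ) (p v : ℂ) : ℝ :=
  fderiv ℝ (fderiv ℝ φ) p v v

/-- The curvature `κ_p = H_φ(p)(J η_p) / ‖η_p‖³`, where `η_p = ∇φ(p)` and `J` is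
multiplication by `i`. -/
noncomputable def boundaryCurvature (φ : ℂ → ℝ) (p : ℂ) : ℝ :=
  realHessian φ p (Complex.I * gradient φ p) / ‖gradient φ p‖ ^ 3

/-- The outward unit normal vector at `p` of the domain with defining function `φ`. -/
noncomputable def outwardUnitNormal (φ : ℂ → ℝ) (p : ℂ) : ℂ :=
  gradient φ p / (‖gradient φ p‖ : ℂ)

/-- The pinched cone `C_{η,ν}(p)` for the outward normal vector `e^{iθ}`. -/
def pinchedCone (θ : ℝ) (p : ℂ) (η ν : ℝ) : Set ℂ :=
  {z | |(Complex.exp (-(θ * Complex.I)) * (z - p)).im| <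
        η * (Complex.exp (-(θ * Complex.I)) * (z - p)).re ^ 2 ∧
      -ν < (Complex.exp (-(θ * Complex.I)) * (z - p)).re ∧
      (Complex.exp (-(θ * Complex.I)) * (z - p)).re < 0}

/-- The open unit disk. -/
def unitDisk : Set ℂ := Metric.ball 0 1

/-- The Kobayashi metric of `Ω` at the point `z` and the vector `ξ`. -/
noncomputable def kobayashiMetric (Ω : Set ℂ) (z ξ : ℂ) : ℝ :=
  sInf {t : ℝ | 0 < t ∧ ∃ f : ℂ → ℂ, DifferentiableOn ℂ f unitDisk ∧
    Set.MapsTo f unitDisk Ω ∧ f 0 = z ∧ (t : ℂ) * deriv f 0 = ξ}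

/-- The Carathéodory metric of `Ω` at the point `z` and the vector `ξ`. -/
noncomputable def caratheodoryMetric (Ω : Set ℂ) (z ξ : ℂ) : ℝ :=
  sSup {t : ℝ | ∃ f : ℂ → ℂ, DifferentiableOn ℂ f Ω ∧
    Set.MapsTo f Ω unitDisk ∧ f z = 0 ∧ t = ‖deriv f z * ξ‖}

/-- A family of metrics `F Ω z ξ`, one for each planar domain `Ω` (`z ∈ Ω`, `ξ` a tangent
vector), is invariant if it agrees with the Kobayashi and the Carathéodory metric on the unit
disk and if holomorphic maps do not increase it. Values at sets that are not domains, or at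
points outside `Ω`, carry no meaning. -/
structure IsInvariantMetric (F : Set ℂ → ℂ → ℂ → ℝ) : Prop where
  nonneg : ∀ Ω, IsPlanarDomain Ω → ∀ z ∈ Ω, ∀ ξ, 0 ≤ F Ω z ξ
  homogeneous : ∀ Ω, IsPlanarDomain Ω → ∀ z ∈ Ω, ∀ c ξ : ℂ, F Ω z (c * ξ) = ‖c‖ * F Ω z ξ
  disk_kobayashi : ∀ z ∈ unitDisk, ∀ ξ, F unitDisk z ξ = kobayashiMetric unitDisk z ξ
  disk_caratheodory : ∀ z ∈ unitDisk, ∀ ξ, F unitDisk z ξ = caratheodoryMetric unitDisk z ξ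
  decreasing : ∀ Ω₁ Ω₂, IsPlanarDomain Ω₁ → IsPlanarDomain Ω₂ →
    ∀ g : ℂ → ℂ, DifferentiableOn ℂ g Ω₁ → Set.MapsTo g Ω₁ Ω₂ →
      ∀ z ∈ Ω₁, ∀ ξ, F Ω₂ (g z) (deriv g z * ξ) ≤ F Ω₁ z ξ

/-- Membership in the Bergman space: holomorphic and square integrable on `D`. -/
def MemBergmanSpace (D : Set ℂ) (f : ℂ → ℂ) : Prop :=
  DifferentiableOn ℂ f D ∧
    MeasureTheory.MemLp f 2 (MeasureTheory.volume.restrict D)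

/-- `B` is the Bergman kernel of `D`, the reproducing kernel of the Bergman space of `D`
(this determines `B` on `D × D`). -/
def IsBergmanKernel (D : Set ℂ) (B : ℂ → ℂ → ℂ) : Prop :=
  ∀ w ∈ D, MemBergmanSpace D (fun z => B z w) ∧
    ∀ f, MemBergmanSpace D f →
      f w = ∫ z in D, f z * (starRingEnd ℂ) (B z w)

/-! An invariant metric and the Bergman density obey one common squeeze, `IsConformallyBounded`:
each is at most the density pushed forward by an injective map of the disk into `D`, and at least
the one pulled back by an injective map of `D` into the disk. For invariant metrics this is
monotonicity; for the Bergman kernel it is the change of variables formula in L², which is why the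
maps are taken injective. It remains to find, in the coordinate ζ = e^{-iθ}(z - p) that turns `D`
into a set S, two global injective maps that are accurate to second order at 0.

The model is the left half-plane H with density 1/(2|Re ω|). Let α = κ/2. If G : H → S has the jet ζ
+ αζ² and g : S → H the jet ζ - αζ², both bounds equal 1/(2|ζ|) + α/2 + O(|ζ|) in the pinched cone,
where Im ζ is of second order (`exists_pinched_bound`, `exists_pinched_estimate`).

As the boundary is of class C⁴, the chart ζ = w + αw² + iβw³ flattens it up to O(|w|⁴) in Re w
(`exists_cubicChart_graph_bounds`). For G (`exists_inner_map`), a Möbius map v takes H onto a disk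
tangent to the axis at 0, where Re v < -|v|²; the polynomial v - v² removes the second-order term of
v, and its real part, below -2(Re v)² ≤ -2|v|⁴, beats the quartic error.

For g (`exists_outer_map`) a local inverse of the chart would not be defined on all of S. Instead a
Möbius map is used, affine in T = 1/ζ + α after inversion; it has no pole on S because Re T is
bounded above there. Near 0 the bound on Re T still contains β Im w. Its contribution is cancelled
by a cubic term in v - v² - iβv³/c², and -2(Re v)² absorbs what remains. -/

open Set Filter Topology MeasureTheory

/-! ### The squeeze, and invariant metrics -/

/-- `m` lies between the densities at `z` that injective holomorphic maps from the unit disk to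
`D`, and from `D` to the unit disk, induce. -/
structure IsConformallyBounded (D : Set ℂ) (z : ℂ) (m : ℝ) : Prop where
  mul_le_one : ∀ G : ℂ → ℂ, DifferentiableOn ℂ G unitDisk → InjOn G unitDisk →
    MapsTo G unitDisk D → G 0 = z → m * ‖deriv G 0‖ ≤ 1
  le : ∀ g : ℂ → ℂ, DifferentiableOn ℂ g D → InjOn g D → MapsTo g D unitDisk → g z = 0 →
    ‖deriv g z‖ ≤ m

theorem zero_mem_unitDisk : (0 : ℂ) ∈ unitDisk := by simp [unitDisk]

theorem isPlanarDomain_unitDisk : IsPlanarDomain unitDisk :=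
  ⟨Metric.isOpen_ball, (convex_ball _ _).isConnected ⟨0, zero_mem_unitDisk⟩⟩

/-- The identity gives one inequality, the Schwarz lemma the other. -/
theorem kobayashiMetric_unitDisk_zero_one : kobayashiMetric unitDisk 0 1 = 1 := by
  refine le_antisymm (csInf_le ⟨0, fun t ht => ht.1.le⟩ ?_) (le_csInf ⟨1, ?_⟩ ?_)
  · exact ⟨one_pos, id, differentiableOn_id, mapsTo_id _, rfl, by simp⟩
  · exact ⟨one_pos, id, differentiableOn_id, mapsTo_id _, rfl, by simp⟩
  · rintro t ⟨ht, f, hf, hm, h0, h1⟩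
    have h := Complex.norm_deriv_le_one_of_mapsTo_ball (c := 0) (R := 1) hf
      (fun x hx => by rw [h0]; exact Metric.ball_subset_closedBall (hm hx)) one_pos
    have h2 : t * ‖deriv f 0‖ = 1 := by
      have := congrArg norm h1
      simpa [abs_of_pos ht] using this
    nlinarith

theorem IsInvariantMetric.unitDisk_zero {F : Set ℂ → ℂ → ℂ → ℝ} (hF : IsInvariantMetric F)
    (ξ : ℂ) : F unitDisk 0 ξ = ‖ξ‖ := by
  have h := hF.homogeneous unitDisk isPlanarDomain_unitDisk 0 zero_mem_unitDisk ξ 1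
  rwa [hF.disk_kobayashi 0 zero_mem_unitDisk 1, kobayashiMetric_unitDisk_zero_one, mul_one,
    mul_one] at h

theorem IsInvariantMetric.isConformallyBounded {F : Set ℂ → ℂ → ℂ → ℝ}
    (hF : IsInvariantMetric F) {D : Set ℂ} (hD : IsPlanarDomain D) {z : ℂ} (hz : z ∈ D) :
    IsConformallyBounded D z (F D z 1) where
  mul_le_one G hG _ hm h0 := by
    have h := hF.decreasing unitDisk D isPlanarDomain_unitDisk hD G hG hm 0 zero_mem_unitDisk 1
    have h1 := hF.homogeneous D hD z hz (deriv G 0) 1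
    rw [h0, h1, hF.unitDisk_zero, norm_one] at h
    linarith
  le g hg _ hm h0 := by
    have h := hF.decreasing D unitDisk hD isPlanarDomain_unitDisk g hg hm z hz 1
    rwa [h0, hF.unitDisk_zero, mul_one] at h

/-! ### Mean values over disks and existence of the Bergman kernel -/

theorem circleMap_polarCoord (q : ℝ × ℝ) : Complex.polarCoord.symm q = circleMap 0 q.1 q.2 := by
  rw [Complex.polarCoord_symm_apply, circleMap, Complex.exp_mul_I]; simp

theorem integral_circleMap_eq {f : ℂ → ℂ} {s : Set ℂ} {w : ℂ} {r : ℝ}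
    (hf : DifferentiableOn ℂ f s) (hr : 0 ≤ r) (hs : Metric.closedBall w r ⊆ s) :
    ∫ τ in Ioo (-Real.pi) Real.pi, f (circleMap w r τ) = 2 * Real.pi * f w := by
  have h1 : Real.circleAverage f w r = f w := by
    refine DiffContOnCl.circleAverage (DifferentiableOn.diffContOnCl ?_)
    rw [abs_of_nonneg hr]
    exact hf.mono (Metric.closure_ball_subset_closedBall.trans hs)
  have h2 : ∫ τ in (-Real.pi)..(-Real.pi + 2 * Real.pi), f (circleMap w r τ) =
      ∫ τ in (0 : ℝ)..(0 + 2 * Real.pi), f (circleMap w r τ) :=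
    Function.Periodic.intervalIntegral_add_eq ((periodic_circleMap w r).comp f) _ _
  rw [← integral_Ioc_eq_integral_Ioo, ← intervalIntegral.integral_of_le (by linarith [Real.pi_pos])]
  rw [show -Real.pi + 2 * Real.pi = Real.pi by ring, zero_add] at h2
  rw [h2, ← h1, Real.circleAverage_def]
  have : (Real.pi : ℂ) ≠ 0 := by exact_mod_cast Real.pi_ne_zero
  simp only [Complex.real_smul]
  push_cast
  field_simp

theorem integral_ball_eq {f : ℂ → ℂ} {s : Set ℂ} {w : ℂ} {r : ℝ}
    (hf : DifferentiableOn ℂ f s) (hr : 0 ≤ r) (hs : Metric.closedBall w r ⊆ s) :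
    ∫ z in Metric.ball w r, f z = Real.pi * r ^ 2 * f w := by
  rw [← integral_indicator Metric.isOpen_ball.measurableSet,
    ← integral_add_left_eq_self _ w, ← Complex.integral_comp_polarCoord_symm]
  have hsub : Ioo 0 r ×ˢ Ioo (-Real.pi) Real.pi ⊆ polarCoord.target := by
    rw [polarCoord_target]
    exact prod_mono Ioo_subset_Ioi_self Subset.rfl
  rw [setIntegral_eq_of_subset_of_forall_sdiff_eq_zero (s := Ioo 0 r ×ˢ Ioo (-Real.pi) Real.pi)
    polarCoord.open_target.measurableSet hsub]
  · have hcongr : ∀ q ∈ Ioo 0 r ×ˢ Ioo (-Real.pi) Real.pi,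
        q.1 • (Metric.ball w r).indicator f (w + Complex.polarCoord.symm q) =
          q.1 • f (circleMap w q.1 q.2) := by
      intro q hq
      have : w + Complex.polarCoord.symm q = circleMap w q.1 q.2 := by
        rw [circleMap_polarCoord]; simp [circleMap]
      rw [this, indicator_of_mem]
      rw [mem_ball_iff_norm, circleMap_sub_center, norm_circleMap_zero, abs_of_pos hq.1.1]
      exact hq.1.2
    rw [setIntegral_congr_fun (measurableSet_Ioo.prod measurableSet_Ioo) hcongr]
    rw [Measure.volume_eq_prod, setIntegral_prod]
    · have : ∀ ρ ∈ Ioo 0 r, ∫ τ in Ioo (-Real.pi) Real.pi, (ρ : ℝ) • f (circleMap w ρ τ) =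
          ρ • (2 * Real.pi * f w) := by
        intro ρ hρ
        rw [integral_smul, integral_circleMap_eq hf hρ.1.le
          ((Metric.closedBall_subset_closedBall hρ.2.le).trans hs)]
      rw [setIntegral_congr_fun measurableSet_Ioo this, integral_smul_const,
        ← integral_Ioc_eq_integral_Ioo, ← intervalIntegral.integral_of_le hr, integral_id]
      simp only [Complex.real_smul]
      push_cast
      ring
    · refine IntegrableOn.mono_set (t := Icc 0 r ×ˢ Icc (-Real.pi) Real.pi) ?_
        (prod_mono Ioo_subset_Icc_self Ioo_subset_Icc_self)
      refine ContinuousOn.integrableOn_compact (isCompact_Icc.prod isCompact_Icc) ?_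
      refine continuousOn_fst.smul (hf.continuousOn.comp (by unfold circleMap; fun_prop) ?_)
      intro q hq
      refine hs ?_
      rw [mem_closedBall_iff_norm, circleMap_sub_center, norm_circleMap_zero, abs_of_nonneg hq.1.1]
      exact hq.1.2
  · intro q hq
    have : w + Complex.polarCoord.symm q ∉ Metric.ball w r := by
      intro hmem
      have h0 := hq.1
      rw [polarCoord_target] at h0
      rw [mem_ball_iff_norm, add_sub_cancel_left, Complex.norm_polarCoord_symm,
        abs_of_pos h0.1] at hmem
      exact hq.2 ⟨⟨h0.1, hmem⟩, h0.2⟩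
    rw [indicator_of_notMem this, smul_zero]

theorem volume_restrict_ball_ne_top (D : Set ℂ) (w : ℂ) (r : ℝ) :
    (volume.restrict D) (Metric.ball w r) ≠ ⊤ :=
  ((Measure.restrict_apply_le _ _).trans_lt measure_ball_lt_top).ne

/-- By the mean value property, point evaluation on the Bergman space is an L² pairing. Both its
continuity and the reproducing kernel come from this. -/
theorem inner_indicatorConstLp_ball {D : Set ℂ} {f : ℂ → ℂ} (hf : MemBergmanSpace D f) {w : ℂ}
    {r : ℝ} (hr : 0 < r) (hs : Metric.closedBall w r ⊆ D) :
    inner ℂ (indicatorConstLp 2 Metric.isOpen_ball.measurableSet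
      (volume_restrict_ball_ne_top D w r) (1 : ℂ)) (hf.2.toLp f) = Real.pi * r ^ 2 * f w := by
  rw [L2.inner_indicatorConstLp_eq_setIntegral_inner,
    Measure.restrict_restrict_of_subset (Metric.ball_subset_closedBall.trans hs),
    ← integral_ball_eq hf.1 hr.le hs]
  refine integral_congr_ae ?_
  have h := ae_restrict_of_ae_restrict_of_subset (Metric.ball_subset_closedBall.trans hs)
    hf.2.coeFn_toLp
  filter_upwards [h] with x hx
  rw [hx]
  simp

theorem norm_mul_le_norm_toLp {D : Set ℂ} {f : ℂ → ℂ} (hf : MemBergmanSpace D f) {w : ℂ} {r : ℝ}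
    (hr : 0 < r) (hs : Metric.closedBall w r ⊆ D) :
    Real.sqrt Real.pi * r * ‖f w‖ ≤ ‖hf.2.toLp f‖ := by
  have h := norm_inner_le_norm (𝕜 := ℂ) (indicatorConstLp 2 Metric.isOpen_ball.measurableSet
    (volume_restrict_ball_ne_top D w r) (1 : ℂ)) (hf.2.toLp f)
  have hvol : (volume.restrict D).real (Metric.ball w r) = Real.pi * r ^ 2 := by
    rw [measureReal_restrict_apply Metric.isOpen_ball.measurableSet,
      inter_eq_left.2 (Metric.ball_subset_closedBall.trans hs), measureReal_def,
      Complex.volume_ball]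
    simp [hr.le, mul_comm]
  rw [inner_indicatorConstLp_ball hf hr hs, norm_indicatorConstLp (by simp) (by simp), hvol] at h
  have hsq : (Real.pi * r ^ 2) ^ (1 / (2 : ENNReal).toReal) = Real.sqrt Real.pi * r := by
    rw [ENNReal.toReal_ofNat, ← Real.sqrt_eq_rpow, Real.sqrt_mul Real.pi_pos.le,
      Real.sqrt_sq hr.le]
  rw [hsq, norm_one, one_mul, norm_mul, norm_mul, norm_pow, Complex.norm_real, Complex.norm_real,
    Real.norm_of_nonneg Real.pi_pos.le, Real.norm_of_nonneg hr.le] at h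
  have hp : 0 < Real.sqrt Real.pi * r := by positivity
  refine le_of_mul_le_mul_left ?_ hp
  refine le_trans (le_of_eq ?_) h
  rw [← mul_assoc]
  congr 1
  calc _ = Real.sqrt Real.pi ^ 2 * r ^ 2 := by ring
    _ = _ := by rw [Real.sq_sqrt Real.pi_pos.le]

/-- Point evaluations are bounded uniformly near each point of `D`, so an L²-Cauchy sequence is
locally uniformly Cauchy. -/
theorem exists_tendstoLocallyUniformlyOn {D : Set ℂ} (hD : IsOpen D) (f : ℕ → ℂ → ℂ)
    (hf : ∀ n, MemBergmanSpace D (f n)) (hc : CauchySeq fun n => (hf n).2.toLp (f n)) :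
    ∃ g, TendstoLocallyUniformlyOn f g atTop D := by
  have key : ∀ w ∈ D, ∃ s ∈ 𝓝[D] w, UniformCauchySeqOn f atTop s := by
    intro w hw
    obtain ⟨r, hr, hs⟩ := Metric.nhds_basis_closedBall.mem_iff.1 (hD.mem_nhds hw)
    refine ⟨Metric.closedBall w (r / 2),
      mem_nhdsWithin_of_mem_nhds (Metric.closedBall_mem_nhds _ (half_pos hr)), ?_⟩
    rw [Metric.uniformCauchySeqOn_iff]
    intro ε hε
    have hc0 : 0 < Real.sqrt Real.pi * (r / 2) := by positivity
    obtain ⟨N, hN⟩ := Metric.cauchySeq_iff.1 hc (Real.sqrt Real.pi * (r / 2) * ε) (by positivity)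
    refine ⟨N, fun m hm n hn z hz => ?_⟩
    have hsub : Metric.closedBall z (r / 2) ⊆ D := by
      refine subset_trans (Metric.closedBall_subset_closedBall' ?_) hs
      rw [Metric.mem_closedBall] at hz
      linarith
    have h1 := norm_mul_le_norm_toLp (f := f m - f n)
      ⟨(hf m).1.sub (hf n).1, (hf m).2.sub (hf n).2⟩ (half_pos hr) hsub
    rw [MemLp.toLp_sub (hf m).2 (hf n).2, ← dist_eq_norm] at h1
    rw [dist_eq_norm]
    exact lt_of_mul_lt_mul_left (h1.trans_lt (hN m hm n hn)) hc0.le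
  have hpt : ∀ w, ∃ l, w ∈ D → Tendsto (fun n => f n w) atTop (𝓝 l) := by
    intro w
    by_cases hw : w ∈ D
    · obtain ⟨s, hs, hu⟩ := key w hw
      obtain ⟨l, hl⟩ := cauchySeq_tendsto_of_complete (hu.cauchySeq (mem_of_mem_nhdsWithin hw hs))
      exact ⟨l, fun _ => hl⟩
    · exact ⟨0, fun h => absurd h hw⟩
  choose g hg using hpt
  refine ⟨g, tendstoLocallyUniformlyOn_of_forall_exists_nhds fun w hw => ?_⟩
  obtain ⟨s, hs, hu⟩ := key w hw
  refine ⟨s ∩ D, inter_mem hs self_mem_nhdsWithin,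
    (hu.mono inter_subset_left).tendstoUniformlyOn_of_tendsto fun x hx => hg x hx.2⟩

/-- The Bergman space of `D` as a subspace of `L²(D)`. -/
noncomputable def bergmanSubmodule (D : Set ℂ) : Submodule ℂ (Lp ℂ 2 (volume.restrict D)) where
  carrier := {u | ∃ f, ∃ hf : MemBergmanSpace D f, hf.2.toLp f = u}
  add_mem' := by
    rintro _ _ ⟨f, hf, rfl⟩ ⟨g, hg, rfl⟩
    exact ⟨f + g, ⟨hf.1.add hg.1, hf.2.add hg.2⟩, MemLp.toLp_add hf.2 hg.2⟩
  zero_mem' := ⟨0, ⟨differentiableOn_const 0, MemLp.zero⟩, rfl⟩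
  smul_mem' := by
    rintro c _ ⟨f, hf, rfl⟩
    exact ⟨c • f, ⟨hf.1.const_smul c, hf.2.const_smul c⟩, MemLp.toLp_const_smul c hf.2⟩

/-- The locally uniform limit is holomorphic, and an a.e. convergent subsequence identifies it with
the L² limit. -/
theorem isClosed_bergmanSubmodule {D : Set ℂ} (hD : IsOpen D) :
    IsClosed (bergmanSubmodule D : Set (Lp ℂ 2 (volume.restrict D))) := by
  refine IsSeqClosed.isClosed fun u v hu huv => ?_
  choose f hf hfu using hu
  obtain ⟨g, hg⟩ := exists_tendstoLocallyUniformlyOn hD f hf (by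
    simpa only [hfu] using huv.cauchySeq)
  have hgd : DifferentiableOn ℂ g D :=
    hg.differentiableOn (Eventually.of_forall fun n => (hf n).1) hD
  obtain ⟨ns, hns, hae⟩ := (tendstoInMeasure_of_tendsto_Lp huv).exists_seq_tendsto_ae
  have hfae : ∀ᵐ x ∂volume.restrict D, ∀ n, u n x = f n x := by
    rw [ae_all_iff]
    intro n
    rw [← hfu n]
    exact (hf n).2.coeFn_toLp
  have hvg : v =ᵐ[volume.restrict D] g := by
    filter_upwards [hae, hfae, ae_restrict_mem hD.measurableSet] with x h1 h2 hx
    refine tendsto_nhds_unique h1 ?_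
    simp only [h2]
    exact (hg.tendsto_at hx).comp hns.tendsto_atTop
  have hgm : MemLp g 2 (volume.restrict D) := (memLp_congr_ae hvg).1 (Lp.memLp v)
  refine ⟨g, ⟨hgd, hgm⟩, ?_⟩
  rw [← Lp.toLp_coeFn v (Lp.memLp v)]
  exact MemLp.toLp_eq_toLp_iff _ _ |>.2 hvg.symm

/-- The kernel at `w` is the orthogonal projection of a normalised disk indicator onto the closed
Bergman space. Off `D` it is set to 0. -/
theorem exists_isBergmanKernel {D : Set ℂ} (hD : IsOpen D) : ∃ B, IsBergmanKernel D B := by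
  have key : ∀ w, ∃ k : ℂ → ℂ, w ∈ D → MemBergmanSpace D k ∧
      ∀ f, MemBergmanSpace D f → f w = ∫ z in D, f z * (starRingEnd ℂ) (k z) := by
    intro w
    by_cases hw : w ∈ D
    swap
    · exact ⟨0, fun h => absurd h hw⟩
    have : CompleteSpace (bergmanSubmodule D) := (isClosed_bergmanSubmodule hD).completeSpace_coe
    obtain ⟨r, hr, hs⟩ := Metric.nhds_basis_closedBall.mem_iff.1 (hD.mem_nhds hw)
    -- The inverse area of the disk; it is conjugated below because the inner product is
    -- conjugate-linear in its first argument.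
    set c : ℂ := (Real.pi * r ^ 2)⁻¹ with hc
    have hc0 : (Real.pi * r ^ 2 : ℂ) ≠ 0 := by
      have : (Real.pi * r ^ 2 : ℝ) ≠ 0 := by positivity
      exact_mod_cast this
    set K := indicatorConstLp 2 Metric.isOpen_ball.measurableSet
      (volume_restrict_ball_ne_top D w r) (1 : ℂ) with hK
    obtain ⟨k, hk, hkP⟩ := ((bergmanSubmodule D).orthogonalProjectionOnto ((starRingEnd ℂ c) • K)).2
    refine ⟨k, fun _ => ⟨hk, fun f hf => ?_⟩⟩
    have h1 := Submodule.inner_orthogonalProjectionOnto_eq_of_mem_right (𝕜 := ℂ)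
      (K := bergmanSubmodule D) ⟨hf.2.toLp f, f, hf, rfl⟩ ((starRingEnd ℂ c) • K)
    rw [Submodule.coe_inner, ← hkP, inner_smul_left, hK, inner_indicatorConstLp_ball hf hr hs,
      Complex.conj_conj, hc, inv_mul_cancel_left₀ hc0, L2.inner_def] at h1
    rw [← h1]
    refine integral_congr_ae ?_
    filter_upwards [hf.2.coeFn_toLp, hk.2.coeFn_toLp] with x hx1 hx2
    rw [hx1, hx2]
    simp
  choose k hk using key
  exact ⟨fun z w => k w z, fun w hw => hk w hw⟩

/-! ### Change of variables and the Bergman density -/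

theorem det_toSpanSingleton_restrictScalars (c : ℂ) :
    ((ContinuousLinearMap.toSpanSingleton ℂ c : ℂ →L[ℂ] ℂ).restrictScalars ℝ).det = ‖c‖ ^ 2 := by
  rw [ContinuousLinearMap.det, ContinuousLinearMap.coe_restrictScalars,
    LinearMap.det_restrictScalars, Algebra.norm_complex_eq]
  simp [Complex.normSq_eq_norm_sq]

theorem lintegral_image_eq_lintegral_norm_deriv_sq {g : ℂ → ℂ} {s : Set ℂ} (hs : IsOpen s)
    (hg : DifferentiableOn ℂ g s) (hi : InjOn g s) (u : ℂ → ENNReal) :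
    ∫⁻ x in g '' s, u x = ∫⁻ x in s, ‖deriv g x‖ₑ ^ 2 * u (g x) := by
  rw [lintegral_image_eq_lintegral_abs_det_fderiv_mul volume hs.measurableSet
    (f' := fun x => (ContinuousLinearMap.toSpanSingleton ℂ (deriv g x) : ℂ →L[ℂ] ℂ).restrictScalars ℝ)
    (fun x hx => ((hg.differentiableAt (hs.mem_nhds hx)).hasDerivAt.hasFDerivAt.restrictScalars
      ℝ).hasFDerivWithinAt) hi]
  refine lintegral_congr fun x => ?_
  rw [det_toSpanSingleton_restrictScalars, abs_of_nonneg (by positivity), ENNReal.ofReal_pow (by positivity),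
    ofReal_norm]

theorem eLpNorm_two_sq {D : Set ℂ} (f : ℂ → ℂ) :
    eLpNorm f 2 (volume.restrict D) ^ 2 = ∫⁻ x in D, ‖f x‖ₑ ^ 2 := by
  rw [eLpNorm_eq_lintegral_rpow_enorm_toReal (by simp) (by simp), ← ENNReal.rpow_natCast, ← ENNReal.rpow_mul]
  simp

/-- For injective `g` the squared L² norm of its derivative is the area of the image, at most π. -/
theorem memBergmanSpace_deriv {D : Set ℂ} (hD : IsOpen D) {g : ℂ → ℂ}
    (hg : DifferentiableOn ℂ g D) (hi : InjOn g D) (hm : MapsTo g D unitDisk) :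
    ∃ h : MemBergmanSpace D (deriv g), ‖h.2.toLp (deriv g)‖ ≤ Real.sqrt Real.pi := by
  have hd : DifferentiableOn ℂ (deriv g) D := hg.deriv hD
  have h1 := lintegral_image_eq_lintegral_norm_deriv_sq hD hg hi 1
  have h2 : eLpNorm (deriv g) 2 (volume.restrict D) ≤ ENNReal.ofReal (Real.sqrt Real.pi) := by
    rw [← ENNReal.pow_le_pow_left_iff two_ne_zero, eLpNorm_two_sq, ← ENNReal.ofReal_pow (by positivity),
      Real.sq_sqrt Real.pi_pos.le]
    simp only [Pi.one_apply, mul_one, lintegral_one, Measure.restrict_apply_univ] at h1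
    rw [← h1]
    refine (measure_mono hm.image_subset).trans (le_of_eq ?_)
    rw [unitDisk, Complex.volume_ball]
    simp only [ENNReal.ofReal_one, one_pow, one_mul]
    rw [← NNReal.coe_real_pi, ENNReal.ofReal_coe_nnreal]
  refine ⟨⟨hd, hd.continuousOn.aestronglyMeasurable hD.measurableSet,
    h2.trans_lt ENNReal.ofReal_lt_top⟩, ?_⟩
  rw [Lp.norm_toLp]
  exact ENNReal.toReal_le_of_le_ofReal (by positivity) h2

/-- The Jacobian of `G` is |G'|², so the weighted pullback has the norm of `f` over the image of
`G`. -/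
theorem memBergmanSpace_comp_mul_deriv {D : Set ℂ} {f G : ℂ → ℂ} (hf : MemBergmanSpace D f)
    (hG : DifferentiableOn ℂ G unitDisk) (hi : InjOn G unitDisk) (hm : MapsTo G unitDisk D) :
    ∃ h : MemBergmanSpace unitDisk (fun ζ => f (G ζ) * deriv G ζ),
      ‖h.2.toLp _‖ ≤ ‖hf.2.toLp f‖ := by
  have hd : DifferentiableOn ℂ (fun ζ => f (G ζ) * deriv G ζ) unitDisk :=
    (hf.1.comp hG hm).mul (hG.deriv Metric.isOpen_ball)
  have h1 := lintegral_image_eq_lintegral_norm_deriv_sq Metric.isOpen_ball hG hi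
    (fun x => ‖f x‖ₑ ^ 2)
  have h2 : eLpNorm (fun ζ => f (G ζ) * deriv G ζ) 2 (volume.restrict unitDisk) ≤
      eLpNorm f 2 (volume.restrict D) := by
    rw [← ENNReal.pow_le_pow_left_iff two_ne_zero, eLpNorm_two_sq, eLpNorm_two_sq]
    refine le_trans (le_of_eq ?_) (lintegral_mono_set hm.image_subset)
    rw [unitDisk, h1]
    refine lintegral_congr fun x => ?_
    rw [enorm_mul, mul_pow, mul_comm]
  refine ⟨⟨hd, hd.continuousOn.aestronglyMeasurable Metric.isOpen_ball.measurableSet,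
    h2.trans_lt hf.2.2⟩, ?_⟩
  rw [Lp.norm_toLp, Lp.norm_toLp]
  exact ENNReal.toReal_mono hf.2.2.ne h2

/-- Let N be the norm of B(·, z), so that B(z, z) = N². The pullback of B(·, z) by `G` has norm at
most N and value N² G'(0) at 0, which the mean value bound compares. Conversely, g'(z) is the
pairing of B(·, z) with g', whose norm is at most √π. -/
theorem IsBergmanKernel.isConformallyBounded {D : Set ℂ} (hD : IsOpen D) {B : ℂ → ℂ → ℂ}
    (hB : IsBergmanKernel D B) {z : ℂ} (hz : z ∈ D) :
    IsConformallyBounded D z (Real.sqrt (Real.pi * (B z z).re)) := by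
  obtain ⟨hb, hrep⟩ := hB z hz
  have hinner : ∀ f (hf : MemBergmanSpace D f),
      f z = inner ℂ (hb.2.toLp (fun x => B x z)) (hf.2.toLp f) := by
    intro f hf
    rw [hrep f hf, L2.inner_def]
    refine integral_congr_ae ?_
    filter_upwards [hf.2.coeFn_toLp, hb.2.coeFn_toLp] with x hx1 hx2
    rw [hx1, hx2]
    simp
  set N := ‖hb.2.toLp (fun x => B x z)‖ with hN
  have hBN : B z z = ((N ^ 2 : ℝ) : ℂ) := by
    have := hinner _ hb
    rw [inner_self_eq_norm_sq_to_K] at this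
    rw [this, hN]
    push_cast
    rfl
  have hsqrt : Real.sqrt (Real.pi * (B z z).re) = Real.sqrt Real.pi * N := by
    rw [hBN, Complex.ofReal_re, Real.sqrt_mul Real.pi_pos.le, Real.sqrt_sq (norm_nonneg _)]
  rw [hsqrt]
  refine ⟨fun G hG hi hm h0 => ?_, fun g hg hi hm h0 => ?_⟩
  · obtain ⟨h, hle⟩ := memBergmanSpace_comp_mul_deriv hb hG hi hm
    -- The mean value bound needs a closed disk inside the domain, hence radii below 1 and a limit.
    have h1 : ∀ r ∈ Ioo (0 : ℝ) 1, r * (Real.sqrt Real.pi * (N ^ 2 * ‖deriv G 0‖)) ≤ N := by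
      intro r hr
      have h2 := (norm_mul_le_norm_toLp h (w := 0) hr.1
        (Metric.closedBall_subset_ball hr.2)).trans hle
      rw [h0, norm_mul, hBN, Complex.norm_real, Real.norm_of_nonneg (sq_nonneg N)] at h2
      linarith
    have h3 : Real.sqrt Real.pi * (N ^ 2 * ‖deriv G 0‖) ≤ N := by
      refine le_of_tendsto (x := 𝓝[<] (1 : ℝ))
        (f := fun r : ℝ => r * (Real.sqrt Real.pi * (N ^ 2 * ‖deriv G 0‖))) ?_
        (eventually_of_mem (Ioo_mem_nhdsLT one_pos) h1)
      have : Tendsto (fun r : ℝ => r * (Real.sqrt Real.pi * (N ^ 2 * ‖deriv G 0‖))) (𝓝 1)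
          (𝓝 (1 * (Real.sqrt Real.pi * (N ^ 2 * ‖deriv G 0‖)))) :=
        (continuous_id.mul continuous_const).tendsto 1
      rw [one_mul] at this
      exact this.mono_left nhdsWithin_le_nhds
    have hN0 : 0 ≤ N := norm_nonneg _
    rcases hN0.eq_or_lt with h | h
    · rw [← h]; simp
    · nlinarith
  · obtain ⟨h, hle⟩ := memBergmanSpace_deriv hD hg hi hm
    have h1 := norm_inner_le_norm (𝕜 := ℂ) (hb.2.toLp (fun x => B x z)) (h.2.toLp (deriv g))
    rw [← hinner _ h, ← hN] at h1
    nlinarith [norm_nonneg (hb.2.toLp (fun x => B x z))]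

/-! ### The half-plane as model -/

/-- The open left half-plane. -/
def leftHalfPlane : Set ℂ := {s | s.re < 0}

theorem isOpen_leftHalfPlane : IsOpen leftHalfPlane :=
  isOpen_lt Complex.continuous_re continuous_const

theorem add_conj_ne_zero {ω s : ℂ} (hω : ω ∈ leftHalfPlane) (hs : s ∈ leftHalfPlane) :
    s + (starRingEnd ℂ) ω ≠ 0 := by
  intro h
  have := congrArg Complex.re h
  simp only [leftHalfPlane, mem_ofPred_eq, Complex.add_re, Complex.conj_re, Complex.zero_re] at *
  linarith

/-- The conformal map of the left half-plane onto the unit disk that sends `ω` to `0`. -/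
noncomputable def cayley (ω s : ℂ) : ℂ := (s - ω) / (s + (starRingEnd ℂ) ω)

/-- The inverse of `cayley ω`. -/
noncomputable def cayleyInv (ω ζ : ℂ) : ℂ := (ω + ζ * (starRingEnd ℂ) ω) / (1 - ζ)

theorem one_sub_ne_zero_of_mem_unitDisk {ζ : ℂ} (hζ : ζ ∈ unitDisk) : 1 - ζ ≠ 0 := by
  intro h
  rw [unitDisk, mem_ball_zero_iff, ← sub_eq_zero.1 h, norm_one] at hζ
  exact lt_irrefl _ hζ

theorem mapsTo_cayley {ω : ℂ} (hω : ω ∈ leftHalfPlane) :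
    MapsTo (cayley ω) leftHalfPlane unitDisk := by
  intro s hs
  have h0 := add_conj_ne_zero hω hs
  rw [unitDisk, mem_ball_zero_iff, cayley, norm_div, div_lt_one (norm_pos_iff.2 h0),
    ← sq_lt_sq₀ (norm_nonneg _) (norm_nonneg _), ← Complex.normSq_eq_norm_sq,
    ← Complex.normSq_eq_norm_sq, Complex.normSq_apply, Complex.normSq_apply]
  simp only [leftHalfPlane, mem_ofPred_eq] at hω hs
  simp only [Complex.sub_re, Complex.sub_im, Complex.add_re, Complex.add_im, Complex.conj_re,
    Complex.conj_im]
  nlinarith [mul_pos_of_neg_of_neg hω hs]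

theorem mapsTo_cayleyInv {ω : ℂ} (hω : ω ∈ leftHalfPlane) :
    MapsTo (cayleyInv ω) unitDisk leftHalfPlane := by
  intro ζ hζ
  have h0 := one_sub_ne_zero_of_mem_unitDisk hζ
  rw [unitDisk, mem_ball_zero_iff, ← sq_lt_one_iff₀ (norm_nonneg _), ← Complex.normSq_eq_norm_sq,
    Complex.normSq_apply] at hζ
  simp only [leftHalfPlane, mem_ofPred_eq] at hω ⊢
  rw [cayleyInv, Complex.div_re, ← add_div]
  refine div_neg_of_neg_of_pos ?_ (Complex.normSq_pos.2 h0)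
  simp only [Complex.sub_re, Complex.sub_im, Complex.add_re, Complex.add_im, Complex.conj_re,
    Complex.conj_im, Complex.mul_re, Complex.mul_im, Complex.one_re, Complex.one_im]
  nlinarith

theorem injOn_cayley {ω : ℂ} (hω : ω ∈ leftHalfPlane) : InjOn (cayley ω) leftHalfPlane := by
  intro s hs s' hs' h
  have hne : ω + (starRingEnd ℂ) ω ≠ 0 := add_conj_ne_zero hω hω
  rw [cayley, cayley, div_eq_div_iff (add_conj_ne_zero hω hs) (add_conj_ne_zero hω hs')] at h
  refine mul_right_cancel₀ hne ?_
  linear_combination h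

theorem injOn_cayleyInv {ω : ℂ} (hω : ω ∈ leftHalfPlane) : InjOn (cayleyInv ω) unitDisk := by
  intro s hs s' hs' h
  have hne : ω + (starRingEnd ℂ) ω ≠ 0 := add_conj_ne_zero hω hω
  rw [cayleyInv, cayleyInv, div_eq_div_iff (one_sub_ne_zero_of_mem_unitDisk hs)
    (one_sub_ne_zero_of_mem_unitDisk hs')] at h
  refine mul_right_cancel₀ hne ?_
  linear_combination h

theorem hasDerivAt_cayley {ω : ℂ} (hω : ω ∈ leftHalfPlane) {s : ℂ} (hs : s ∈ leftHalfPlane) :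
    HasDerivAt (cayley ω) ((ω + (starRingEnd ℂ) ω) / (s + (starRingEnd ℂ) ω) ^ 2) s := by
  have h := ((hasDerivAt_id s).sub_const ω).div ((hasDerivAt_id s).add_const ((starRingEnd ℂ) ω))
    (add_conj_ne_zero hω hs)
  refine h.congr_deriv ?_
  simp [add_comm]

theorem hasDerivAt_cayleyInv {ω ζ : ℂ} (hζ : ζ ∈ unitDisk) :
    HasDerivAt (cayleyInv ω) ((ω + (starRingEnd ℂ) ω) / (1 - ζ) ^ 2) ζ := by
  have h := (((hasDerivAt_id ζ).mul_const ((starRingEnd ℂ) ω)).const_add ω).div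
    ((hasDerivAt_id ζ).const_sub 1) (one_sub_ne_zero_of_mem_unitDisk hζ)
  refine h.congr_deriv ?_
  simp
  ring

theorem norm_add_conj {ω : ℂ} (hω : ω ∈ leftHalfPlane) :
    ‖ω + (starRingEnd ℂ) ω‖ = 2 * -ω.re := by
  rw [Complex.add_conj, Complex.norm_real, Real.norm_eq_abs, abs_of_neg]
  · ring
  · simp only [leftHalfPlane, mem_ofPred_eq] at hω
    linarith

theorem IsConformallyBounded.mul_le_one_of_leftHalfPlane {D : Set ℂ} {z : ℂ} {m : ℝ}
    (hm : IsConformallyBounded D z m) {G : ℂ → ℂ} (hG : DifferentiableOn ℂ G leftHalfPlane)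
    (hi : InjOn G leftHalfPlane) (hD : MapsTo G leftHalfPlane D) {ω : ℂ}
    (hω : ω ∈ leftHalfPlane) (h0 : G ω = z) : m * (2 * -ω.re * ‖deriv G ω‖) ≤ 1 := by
  have hc0 : cayleyInv ω 0 = ω := by simp [cayleyInv]
  have h := hm.mul_le_one (G ∘ cayleyInv ω)
    (hG.comp (fun x hx => (hasDerivAt_cayleyInv hx).differentiableAt.differentiableWithinAt)
      (mapsTo_cayleyInv hω))
    (hi.comp (injOn_cayleyInv hω) (mapsTo_cayleyInv hω)) (hD.comp (mapsTo_cayleyInv hω))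
    (by simp [hc0, h0])
  have hd : HasDerivAt G (deriv G ω) (cayleyInv ω 0) := by
    rw [hc0]
    exact (hG.differentiableAt (isOpen_leftHalfPlane.mem_nhds hω)).hasDerivAt
  rw [(hd.comp 0 (hasDerivAt_cayleyInv zero_mem_unitDisk)).deriv, norm_mul] at h
  simp only [sub_zero, one_pow, div_one] at h
  rwa [norm_add_conj hω, mul_comm ‖deriv G ω‖] at h

theorem IsConformallyBounded.norm_deriv_le {D : Set ℂ} (hDo : IsOpen D) {z : ℂ} (hz : z ∈ D)
    {m : ℝ} (hm : IsConformallyBounded D z m) {g : ℂ → ℂ} (hg : DifferentiableOn ℂ g D)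
    (hi : InjOn g D) (hD : MapsTo g D leftHalfPlane) : ‖deriv g z‖ ≤ m * (2 * -(g z).re) := by
  have hω := hD hz
  have h := hm.le (cayley (g z) ∘ g)
    (DifferentiableOn.comp (t := leftHalfPlane)
      (fun x hx => (hasDerivAt_cayley hω hx).differentiableAt.differentiableWithinAt) hg hD)
    ((injOn_cayley hω).comp hi hD) ((mapsTo_cayley hω).comp hD) (by simp [cayley])
  rw [((hasDerivAt_cayley hω hω).comp z
    (hg.differentiableAt (hDo.mem_nhds hz)).hasDerivAt).deriv, norm_mul, norm_div, norm_pow,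
    norm_add_conj hω] at h
  have hp : 0 < 2 * -(g z).re := by
    have : (g z).re < 0 := hω
    linarith
  rw [pow_two, div_mul_eq_div_div, div_self hp.ne', one_div, inv_mul_le_iff₀ hp] at h
  linarith

/-! ### Asymptotics in the pinched cone -/

-- One estimate for both bounds: (s, d) will be (g(ζ), g'(ζ)) and (ω, 1/G'(ω)) with G(ω) = ζ. For t
-- = -Re ζ the cone gives -Re s = t + αt² + O(t³), |d| = 1 + 2αt + O(t²) and |ζ| = t + O(t³).
set_option maxHeartbeats 1000000 in
theorem exists_pinched_bound (α : ℝ) {K η : ℝ} (hK : 0 ≤ K) (hη : 0 < η) :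
    ∃ ν > 0, ∃ C, ∀ ζ s d : ℂ, |ζ.im| < η * ζ.re ^ 2 → -ν < ζ.re → ζ.re < 0 →
      ‖s - (ζ - α * ζ ^ 2)‖ ≤ K * ‖ζ‖ ^ 3 → ‖d - (1 - 2 * α * ζ)‖ ≤ K * ‖ζ‖ ^ 2 →
      s.re < 0 ∧ |‖d‖ / (2 * -s.re) - (1 / (2 * ‖ζ‖) + α / 2)| ≤ C * ‖ζ‖ := by
  -- The 8 comes from |ζ| ≤ 2t; the other terms bound 2α Im ζ in `d` and α(Im ζ)² in Re s.
  set M : ℝ := 8 * K + 2 * |α| * η + |α| * η ^ 2 with hM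
  have hM0 : 0 ≤ M := by positivity
  have hν : 0 < 1 + η + 4 * |α| + 4 * M := by positivity
  refine ⟨1 / (1 + η + 4 * |α| + 4 * M), by positivity, 3 * M + α ^ 2 + η ^ 2, ?_⟩
  intro ζ s d him hre hre0 hs hd
  set t := -ζ.re with ht
  have ht0 : 0 < t := by linarith
  have htν : t * (1 + η + 4 * |α| + 4 * M) < 1 := by
    rw [← lt_div_iff₀ hν]; linarith
  have ht1 : t ≤ 1 := by nlinarith [abs_nonneg α]
  have htη : t * η ≤ 1 := by nlinarith [abs_nonneg α]
  have htα : t * |α| ≤ 1 / 4 := by nlinarith [abs_nonneg α]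
  have htM : t * M ≤ 1 / 4 := by nlinarith [abs_nonneg α]
  have hre2 : ζ.re ^ 2 = t ^ 2 := by rw [ht]; ring
  rw [hre2] at him
  have hσt : |ζ.im| ≤ t := by nlinarith
  have hn2 : ‖ζ‖ ^ 2 = t ^ 2 + ζ.im ^ 2 := by
    rw [← Complex.normSq_eq_norm_sq, Complex.normSq_apply]; nlinarith
  have hσ2 : ζ.im ^ 2 ≤ η ^ 2 * t ^ 4 := by
    rw [← sq_abs]
    nlinarith [abs_nonneg ζ.im]
  have hnt : t ≤ ‖ζ‖ := by
    refine le_of_sq_le_sq ?_ (norm_nonneg _)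
    nlinarith [sq_nonneg ζ.im]
  have hn2t : ‖ζ‖ ≤ 2 * t := by
    refine le_of_sq_le_sq ?_ (by linarith)
    nlinarith [sq_abs ζ.im, abs_nonneg ζ.im]
  have hn3 : ‖ζ‖ ^ 3 ≤ 8 * t ^ 3 := by
    calc ‖ζ‖ ^ 3 ≤ (2 * t) ^ 3 := by gcongr
      _ = _ := by ring
  have hn4 : ‖ζ‖ ^ 2 ≤ 4 * t ^ 2 := by
    calc ‖ζ‖ ^ 2 ≤ (2 * t) ^ 2 := by gcongr
      _ = _ := by ring
  have hα0 := abs_nonneg α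
  -- the real part of `s`
  obtain ⟨e, he⟩ : ∃ e, -s.re = t + α * t ^ 2 + e := ⟨-s.re - (t + α * t ^ 2), by ring⟩
  have heM : |e| ≤ M * t ^ 3 := by
    have h1 := (Complex.abs_re_le_norm _).trans hs
    have h2 : (s - (ζ - α * ζ ^ 2)).re = -e - α * ζ.im ^ 2 := by
      simp [pow_two]
      linear_combination (-1 : ℝ) * he + (α * (t - ζ.re)) * ht + ht
    rw [h2] at h1
    have h3 : |α * ζ.im ^ 2| ≤ |α| * η ^ 2 * t ^ 3 := by
      rw [abs_mul, abs_of_nonneg (sq_nonneg ζ.im), mul_assoc]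
      gcongr
      refine hσ2.trans ?_
      gcongr ?_ * ?_
      exact pow_le_pow_of_le_one ht0.le ht1 (by norm_num)
    have h4 : |e| ≤ |-e - α * ζ.im ^ 2| + |α * ζ.im ^ 2| := by
      calc |e| = |-(-e - α * ζ.im ^ 2) - α * ζ.im ^ 2| := by ring_nf
        _ ≤ _ := by rw [← abs_neg (-e - α * ζ.im ^ 2)]; exact abs_sub _ _
    have h5 : K * ‖ζ‖ ^ 3 ≤ K * (8 * t ^ 3) := by gcongr
    have h6 : 0 ≤ 2 * |α| * η * t ^ 3 := by positivity
    rw [hM]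
    linarith
  obtain ⟨e', he'⟩ : ∃ e', ‖d‖ = 1 + 2 * α * t + e' := ⟨‖d‖ - (1 + 2 * α * t), by ring⟩
  have heM' : |e'| ≤ M * t ^ 2 := by
    have h0 : 0 ≤ 1 + 2 * α * t := by nlinarith [neg_abs_le α]
    have h1 : |e'| ≤ ‖d - ((1 + 2 * α * t : ℝ) : ℂ)‖ := by
      have : e' = ‖d‖ - ‖((1 + 2 * α * t : ℝ) : ℂ)‖ := by
        rw [Complex.norm_real, Real.norm_of_nonneg h0]; linarith
      rw [this]
      exact abs_norm_sub_norm_le _ _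
    have h2 : d - ((1 + 2 * α * t : ℝ) : ℂ) =
        (d - (1 - 2 * α * ζ)) - ((2 * α * ζ.im : ℝ) : ℂ) * Complex.I := by
      have : ζ = -(t : ℂ) + ζ.im * Complex.I := by
        conv_lhs => rw [← Complex.re_add_im ζ]
        rw [ht]; push_cast; ring
      conv_rhs => rw [this]
      simp
      ring
    have h3 : ‖((2 * α * ζ.im : ℝ) : ℂ) * Complex.I‖ ≤ 2 * |α| * η * t ^ 2 := by
      rw [norm_mul, Complex.norm_I, mul_one, Complex.norm_real, Real.norm_eq_abs, abs_mul, abs_mul,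
        abs_two, mul_assoc (2 * |α|)]
      gcongr
    rw [h2] at h1
    have h4 := (h1.trans (norm_sub_le _ _)).trans (add_le_add hd h3)
    have h5 : K * ‖ζ‖ ^ 2 ≤ K * (4 * t ^ 2) := by gcongr
    have h6 : 0 ≤ |α| * η ^ 2 * t ^ 2 := by positivity
    have h7 : 0 ≤ K * t ^ 2 := by positivity
    rw [hM]
    linarith
  have hR : t / 2 ≤ -s.re := by
    rw [he]
    have h1 : |e| ≤ t * (1 / 4) := by
      refine heM.trans ?_
      calc M * t ^ 3 = (t * M) * t * t := by ring
        _ ≤ (1 / 4) * 1 * t := by gcongr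
        _ = _ := by ring
    have h2 : |α * t ^ 2| ≤ t * (1 / 4) := by
      rw [abs_mul, abs_of_nonneg (sq_nonneg t)]
      calc |α| * t ^ 2 = t * (t * |α|) := by ring
        _ ≤ _ := by gcongr
    linarith [neg_abs_le e, neg_abs_le (α * t ^ 2)]
  refine ⟨by linarith, ?_⟩
  have hRpos : 0 < -s.re := by linarith
  have hζ0 : 0 < ‖ζ‖ := by linarith
  have hA : |‖d‖ / (2 * -s.re) - (1 / (2 * t) + α / 2)| ≤ (3 * M + α ^ 2) * t := by
    -- In t|d| - (1 + αt)(-Re s) the terms in t and t² cancel, so the numerator is O(t³) against a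
    -- denominator of order t².
    have h1 : ‖d‖ / (2 * -s.re) - (1 / (2 * t) + α / 2) =
        (t * e' - α ^ 2 * t ^ 3 - (1 + α * t) * e) / (2 * t * -s.re) := by
      have h2 : e = -s.re - t - α * t ^ 2 := by rw [he]; ring
      rw [he', h2]
      generalize -s.re = R at hRpos
      have := hRpos.ne'
      field_simp
      ring
    rw [h1, abs_div, abs_of_pos (by positivity : 0 < 2 * t * -s.re), div_le_iff₀ (by positivity)]
    have h3 : |t * e' - α ^ 2 * t ^ 3 - (1 + α * t) * e| ≤ (3 * M + α ^ 2) * t ^ 3 := by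
      have b1 : |t * e'| ≤ M * t ^ 3 := by
        rw [abs_mul, abs_of_pos ht0]
        calc t * |e'| ≤ t * (M * t ^ 2) := by gcongr
          _ = _ := by ring
      have b2 : |(1 + α * t) * e| ≤ 2 * (M * t ^ 3) := by
        rw [abs_mul]
        have : |1 + α * t| ≤ 2 := by
          refine (abs_add_le _ _).trans ?_
          rw [abs_one, abs_mul, abs_of_pos ht0]
          linarith
        gcongr
      have b3 : |α ^ 2 * t ^ 3| = α ^ 2 * t ^ 3 := abs_of_nonneg (by positivity)
      have b4 := abs_sub (t * e' - α ^ 2 * t ^ 3) ((1 + α * t) * e)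
      have b5 := abs_sub (t * e') (α ^ 2 * t ^ 3)
      linarith
    refine h3.trans ?_
    calc (3 * M + α ^ 2) * t ^ 3 = (3 * M + α ^ 2) * t * (2 * t * (t / 2)) := by ring
      _ ≤ _ := by gcongr
  have hB : |1 / (2 * t) - 1 / (2 * ‖ζ‖)| ≤ η ^ 2 * t := by
    have h1 : 1 / (2 * t) - 1 / (2 * ‖ζ‖) = (‖ζ‖ - t) / (2 * t * ‖ζ‖) := by
      field_simp
    rw [h1, abs_of_nonneg (div_nonneg (by linarith) (by positivity)), div_le_iff₀ (by positivity)]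
    have h2 : (‖ζ‖ - t) * t ≤ η ^ 2 * t ^ 4 := by nlinarith
    have h3 : ‖ζ‖ - t ≤ η ^ 2 * t ^ 3 := by
      refine le_of_mul_le_mul_right ?_ ht0
      linarith
    have h4 : 0 ≤ η ^ 2 * t * t * ‖ζ‖ := by positivity
    calc ‖ζ‖ - t ≤ η ^ 2 * t ^ 3 := h3
      _ = η ^ 2 * t * (t * t) := by ring
      _ ≤ η ^ 2 * t * (t * ‖ζ‖) := by gcongr
      _ ≤ η ^ 2 * t * (2 * t * ‖ζ‖) := by gcongr; linarith
  calc |‖d‖ / (2 * -s.re) - (1 / (2 * ‖ζ‖) + α / 2)|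
      = |(‖d‖ / (2 * -s.re) - (1 / (2 * t) + α / 2)) + (1 / (2 * t) - 1 / (2 * ‖ζ‖))| := by
        ring_nf
    _ ≤ (3 * M + α ^ 2) * t + η ^ 2 * t := (abs_add_le _ _).trans (add_le_add hA hB)
    _ = (3 * M + α ^ 2 + η ^ 2) * t := by ring
    _ ≤ _ := by gcongr

/-! ### Quadratic jets and their local inverses -/

/-- `G` is holomorphic near `0` with Taylor expansion `ζ + a ζ² + O(ζ³)`. -/
def HasQuadraticJet (G : ℂ → ℂ) (a : ℂ) : Prop :=
  ∃ R : ℂ → ℂ, AnalyticAt ℂ R 0 ∧ ∀ᶠ ζ in 𝓝 0, G ζ = ζ + a * ζ ^ 2 + ζ ^ 3 * R ζ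

namespace HasQuadraticJet

variable {G : ℂ → ℂ} {a : ℂ}

theorem analyticAt (h : HasQuadraticJet G a) : AnalyticAt ℂ G 0 := by
  obtain ⟨R, hR, he⟩ := h
  have : AnalyticAt ℂ (fun ζ => ζ + a * ζ ^ 2 + ζ ^ 3 * R ζ) 0 := by fun_prop
  exact this.congr (he.mono fun ζ hζ => hζ.symm)

theorem map_zero (h : HasQuadraticJet G a) : G 0 = 0 := by
  obtain ⟨R, hR, he⟩ := h
  simpa using he.self_of_nhds

theorem eventually_deriv (h : HasQuadraticJet G a) :
    ∃ S : ℂ → ℂ, ContinuousAt S 0 ∧ ∀ᶠ ζ in 𝓝 0, deriv G ζ = 1 + 2 * a * ζ + ζ ^ 2 * S ζ := by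
  obtain ⟨R, hR, he⟩ := h
  refine ⟨fun ζ => 3 * R ζ + ζ * deriv R ζ, ?_, ?_⟩
  · have h1 := hR.continuousAt
    have h2 := hR.deriv.continuousAt
    fun_prop
  · filter_upwards [he.eventually_nhds, hR.eventually_analyticAt] with ζ h1 h2
    have h3 := h2.differentiableAt.hasDerivAt
    have h4 : HasDerivAt (fun ζ => ζ + a * ζ ^ 2 + ζ ^ 3 * R ζ)
        (1 + a * (2 * ζ) + (3 * ζ ^ 2 * R ζ + ζ ^ 3 * deriv R ζ)) ζ := by
      have := ((hasDerivAt_id ζ).add ((hasDerivAt_pow 2 ζ).const_mul a)).add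
        ((hasDerivAt_pow 3 ζ).mul h3)
      refine this.congr_deriv ?_
      simp
    rw [(h4.congr_of_eventuallyEq h1).deriv]
    ring

theorem deriv_zero (h : HasQuadraticJet G a) : deriv G 0 = 1 := by
  obtain ⟨S, -, he⟩ := h.eventually_deriv
  simpa using he.self_of_nhds

theorem hasStrictDerivAt (h : HasQuadraticJet G a) : HasStrictDerivAt G 1 0 := by
  rw [← h.deriv_zero]
  exact h.analyticAt.hasStrictDerivAt

theorem exists_bound (h : HasQuadraticJet G a) :
    ∃ K, 0 ≤ K ∧ ∀ᶠ ζ in 𝓝 0, ‖G ζ - (ζ + a * ζ ^ 2)‖ ≤ K * ‖ζ‖ ^ 3 ∧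
      ‖deriv G ζ - (1 + 2 * a * ζ)‖ ≤ K * ‖ζ‖ ^ 2 := by
  obtain ⟨S, hS, hSe⟩ := h.eventually_deriv
  obtain ⟨R, hR, he⟩ := h
  refine ⟨max (‖R 0‖ + 1) (‖S 0‖ + 1), by positivity, ?_⟩
  filter_upwards [he, hSe, hR.continuousAt.norm.eventually_lt_const (lt_add_one ‖R 0‖),
    hS.norm.eventually_lt_const (lt_add_one ‖S 0‖)] with ζ h1 h2 h3 h4
  constructor
  · rw [h1, add_sub_cancel_left, norm_mul, norm_pow, mul_comm]
    gcongr
    exact h3.le.trans (le_max_left _ _)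
  · rw [h2, add_sub_cancel_left, norm_mul, norm_pow, mul_comm]
    gcongr
    exact h4.le.trans (le_max_right _ _)

/-- The derivative 1 at 0 makes `G` open there, and near 0 the identity dominates the higher terms
of `G`. -/
theorem exists_preimage (h : HasQuadraticJet G a) {s : Set ℂ} (hs : s ∈ 𝓝 0) :
    ∀ᶠ z in 𝓝 0, ∃ ω ∈ s, G ω = z ∧ ‖ω‖ ≤ 2 * ‖z‖ := by
  have hmap : map G (𝓝 0) = 𝓝 0 := by
    rw [h.hasStrictDerivAt.map_nhds_eq one_ne_zero, h.map_zero]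
  obtain ⟨K, hK, he⟩ := h.exists_bound
  have hsmall : ∀ᶠ ω : ℂ in 𝓝 0, (‖a‖ + K) * ‖ω‖ < 1 / 2 ∧ ‖ω‖ < 1 := by
    have h1 : ContinuousAt (fun ω : ℂ => (‖a‖ + K) * ‖ω‖) 0 := by fun_prop
    have h2 : ContinuousAt (fun ω : ℂ => ‖ω‖) 0 := by fun_prop
    exact (h1.eventually_lt_const (by simp)).and (h2.eventually_lt_const (by simp))
  have : s ∩ {ω | ‖ω‖ ≤ 2 * ‖G ω‖} ∈ 𝓝 (0 : ℂ) := by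
    refine inter_mem hs ?_
    filter_upwards [he, hsmall] with ω h1 h2
    have h3 : ‖ω‖ ≤ ‖G ω‖ + ‖G ω - (ω + a * ω ^ 2)‖ + ‖a * ω ^ 2‖ := by
      have : ω = G ω - (G ω - (ω + a * ω ^ 2)) - a * ω ^ 2 := by ring
      calc ‖ω‖ = ‖G ω - (G ω - (ω + a * ω ^ 2)) - a * ω ^ 2‖ := by rw [← this]
        _ ≤ _ := (norm_sub_le _ _).trans (add_le_add_left (norm_sub_le _ _) _)
    have h4 : ‖a * ω ^ 2‖ = ‖a‖ * ‖ω‖ * ‖ω‖ := by rw [norm_mul, norm_pow]; ring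
    have h5 : K * ‖ω‖ ^ 3 ≤ K * ‖ω‖ * ‖ω‖ := by
      have : 0 ≤ K * ‖ω‖ * ‖ω‖ := by positivity
      calc K * ‖ω‖ ^ 3 = (K * ‖ω‖ * ‖ω‖) * ‖ω‖ := by ring
        _ ≤ (K * ‖ω‖ * ‖ω‖) * 1 := by gcongr; exact h2.2.le
        _ = _ := by ring
    have h6 : (‖a‖ + K) * ‖ω‖ * ‖ω‖ ≤ 1 / 2 * ‖ω‖ := by gcongr; exact h2.1.le
    show ‖ω‖ ≤ 2 * ‖G ω‖
    linarith [h1.1]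
  have h2 := image_mem_map (m := G) this
  rw [hmap] at h2
  filter_upwards [h2] with z hz
  obtain ⟨ω, hω, rfl⟩ := hz
  exact ⟨ω, hω.1, rfl, hω.2⟩

theorem exists_inverse_bound (h : HasQuadraticJet G a) :
    ∃ K, 0 ≤ K ∧ ∀ᶠ z in 𝓝 0, ∃ ω, G ω = z ∧ deriv G ω ≠ 0 ∧
      ‖ω - (z - a * z ^ 2)‖ ≤ K * ‖z‖ ^ 3 ∧
      ‖(deriv G ω)⁻¹ - (1 - 2 * a * z)‖ ≤ K * ‖z‖ ^ 2 := by
  obtain ⟨K, hK, he⟩ := h.exists_bound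
  set M := ‖a‖ with hM
  have hM0 : 0 ≤ M := norm_nonneg _
  have hsmall : ∀ᶠ ω : ℂ in 𝓝 0, ‖ω‖ < 1 ∧ ‖deriv G ω - 1‖ < 1 / 2 := by
    have h1 : ContinuousAt (fun ω : ℂ => ‖deriv G ω - 1‖) 0 := by
      have := h.analyticAt.deriv.continuousAt
      fun_prop
    have h2 : ContinuousAt (fun ω : ℂ => ‖ω‖) 0 := by fun_prop
    exact (h2.eventually_lt_const (by simp)).and
      (h1.eventually_lt_const (by simp [h.deriv_zero]))
  have hzs : ∀ᶠ z : ℂ in 𝓝 0, 2 * M * ‖z‖ < 1 := by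
    have h1 : ContinuousAt (fun z : ℂ => 2 * M * ‖z‖) 0 := by fun_prop
    exact h1.eventually_lt_const (by simp)
  refine ⟨8 * K + 12 * M * (M + K) + 2 * (8 * M * (M + K) + 8 * M ^ 2 + 8 * K), by positivity, ?_⟩
  filter_upwards [h.exists_preimage (he.and hsmall), hzs] with z hz hz1
  obtain ⟨ω, ⟨⟨h1, h2⟩, h3, h4⟩, rfl, h5⟩ := hz
  set z := G ω
  have hω2 : ‖ω‖ ^ 2 ≤ 4 * ‖z‖ ^ 2 := by
    calc ‖ω‖ ^ 2 ≤ (2 * ‖z‖) ^ 2 := by gcongr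
      _ = _ := by ring
  have hω3 : ‖ω‖ ^ 3 ≤ 8 * ‖z‖ ^ 3 := by
    calc ‖ω‖ ^ 3 ≤ (2 * ‖z‖) ^ 3 := by gcongr
      _ = _ := by ring
  have hω32 : ‖ω‖ ^ 3 ≤ 4 * ‖z‖ ^ 2 :=
    (pow_le_pow_of_le_one (norm_nonneg _) h3.le (by norm_num)).trans hω2
  have hA : ‖z - (ω + a * ω ^ 2)‖ ≤ 8 * K * ‖z‖ ^ 3 := by
    refine h1.trans ?_
    calc K * ‖ω‖ ^ 3 ≤ K * (8 * ‖z‖ ^ 3) := by gcongr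
      _ = _ := by ring
  have hB : ‖z - ω‖ ≤ 4 * (M + K) * ‖z‖ ^ 2 := by
    have : z - ω = (z - (ω + a * ω ^ 2)) + a * ω ^ 2 := by ring
    rw [this]
    refine (norm_add_le _ _).trans ?_
    rw [norm_mul, norm_pow, ← hM]
    have b1 : K * ‖ω‖ ^ 3 ≤ K * (4 * ‖z‖ ^ 2) := by gcongr
    have b2 : M * ‖ω‖ ^ 2 ≤ M * (4 * ‖z‖ ^ 2) := by gcongr
    linarith
  have hD : 1 / 2 ≤ ‖deriv G ω‖ := by
    have := norm_sub_norm_le (1 : ℂ) (1 - deriv G ω)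
    rw [sub_sub_cancel, norm_one, norm_sub_rev] at this
    linarith
  have hD0 : deriv G ω ≠ 0 := by
    rw [← norm_pos_iff]; linarith
  have hz0 := norm_nonneg z
  refine ⟨ω, rfl, hD0, ?_, ?_⟩
  · have e1 : ω - (z - a * z ^ 2) = -(z - (ω + a * ω ^ 2)) + a * ((z - ω) * (z + ω)) := by ring
    have e2 : ‖a * ((z - ω) * (z + ω))‖ ≤ M * (4 * (M + K) * ‖z‖ ^ 2 * (3 * ‖z‖)) := by
      rw [norm_mul, norm_mul]
      gcongr
      refine (norm_add_le _ _).trans ?_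
      linarith
    rw [e1]
    refine (norm_add_le _ _).trans ?_
    rw [norm_neg]
    have e3 : 0 ≤ 2 * (8 * M * (M + K) + 8 * M ^ 2 + 8 * K) * ‖z‖ ^ 3 := by positivity
    linarith
  -- Factor out 1/G'(ω) and use (1 + 2aω)(1 - 2az) = 1 - 2a(z - ω) - 4a²ωz; each remaining term is
  -- O(|z|²).
  · have e1 : (deriv G ω)⁻¹ - (1 - 2 * a * z) = (deriv G ω)⁻¹ *
        (2 * a * (z - ω) + 4 * a ^ 2 * (ω * z)
          - (deriv G ω - (1 + 2 * a * ω)) * (1 - 2 * a * z)) := by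
      field_simp
      ring
    have e2 : ‖2 * a * (z - ω)‖ ≤ 2 * M * (4 * (M + K) * ‖z‖ ^ 2) := by
      rw [norm_mul, norm_mul, Complex.norm_ofNat]
      gcongr
    have e3 : ‖4 * a ^ 2 * (ω * z)‖ ≤ 4 * M ^ 2 * (2 * ‖z‖ * ‖z‖) := by
      rw [norm_mul, norm_mul, norm_mul, norm_pow, Complex.norm_ofNat]
      gcongr
    have e4 : ‖(deriv G ω - (1 + 2 * a * ω)) * (1 - 2 * a * z)‖ ≤ K * (4 * ‖z‖ ^ 2) * 2 := by
      rw [norm_mul]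
      gcongr
      · refine h2.trans ?_
        gcongr
      · refine (norm_sub_le _ _).trans ?_
        rw [norm_one, norm_mul, norm_mul, Complex.norm_ofNat]
        linarith
    have e5 : ‖(deriv G ω)⁻¹‖ ≤ 2 := by
      rw [norm_inv]
      exact inv_le_of_inv_le₀ (by norm_num) (by linarith)
    rw [e1, norm_mul]
    have e6 := (norm_sub_le (2 * a * (z - ω) + 4 * a ^ 2 * (ω * z))
      ((deriv G ω - (1 + 2 * a * ω)) * (1 - 2 * a * z))).trans
      (add_le_add_left (norm_add_le _ _) _)
    have e7 : 0 ≤ (8 * K + 12 * M * (M + K)) * ‖z‖ ^ 2 := by positivity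
    calc _ ≤ 2 * (2 * M * (4 * (M + K) * ‖z‖ ^ 2) + 4 * M ^ 2 * (2 * ‖z‖ * ‖z‖)
          + K * (4 * ‖z‖ ^ 2) * 2) := by
          gcongr
          linarith
      _ ≤ _ := by linarith

end HasQuadraticJet

/-! ### From jets to the estimate of the density -/

theorem IsConformallyBounded.comp_affine {D : Set ℂ} (hD : IsOpen D) {p e ζ : ℂ} {m : ℝ}
    (he : ‖e‖ = 1) (hζ : p + e * ζ ∈ D) (h : IsConformallyBounded D (p + e * ζ) m) :
    IsConformallyBounded {ζ | p + e * ζ ∈ D} ζ m := by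
  have he0 : e ≠ 0 := norm_ne_zero_iff.1 (by rw [he]; exact one_ne_zero)
  refine ⟨fun G hG hi hm h0 => ?_, fun g hg hi hm h0 => ?_⟩
  · have h1 := h.mul_le_one (fun x => p + e * G x) ((hG.const_mul e).const_add p)
      (fun x hx y hy hxy => hi hx hy (mul_left_cancel₀ he0 (add_left_cancel hxy))) hm (by simp [h0])
    have h2 := (hG.differentiableAt (Metric.isOpen_ball.mem_nhds zero_mem_unitDisk)).hasDerivAt
    rwa [((h2.const_mul e).const_add p).deriv, norm_mul, he, one_mul] at h1
  · have hinv : ∀ x, p + e * (e⁻¹ * (x - p)) = x := by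
      intro x; field_simp; ring
    have hmaps : MapsTo (fun x => e⁻¹ * (x - p)) D {ζ | p + e * ζ ∈ D} := by
      intro x hx
      show p + e * (e⁻¹ * (x - p)) ∈ D
      rwa [hinv]
    have hcancel : e⁻¹ * (p + e * ζ - p) = ζ := by field_simp; ring
    have hder : ∀ x, HasDerivAt (fun x => e⁻¹ * (x - p)) e⁻¹ x := fun x => by
      simpa using ((hasDerivAt_id x).sub_const p).const_mul e⁻¹
    have h1 := h.le (g ∘ fun x => e⁻¹ * (x - p))
      (hg.comp (fun x _ => (hder x).differentiableAt.differentiableWithinAt) hmaps)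
      (hi.comp (fun x _ y _ hxy => by
        have := congrArg (fun u => p + e * u) hxy
        simpa only [hinv] using this) hmaps) (hm.comp hmaps)
      (by simp only [Function.comp_apply, hcancel, h0])
    have hS : IsOpen {ζ | p + e * ζ ∈ D} := hD.preimage (by fun_prop)
    have h2 : HasDerivAt g (deriv g ζ) (e⁻¹ * (p + e * ζ - p)) := by
      rw [hcancel]
      exact (hg.differentiableAt (hS.mem_nhds hζ)).hasDerivAt
    have h3 := HasDerivAt.comp (h := fun x => e⁻¹ * (x - p)) (p + e * ζ) h2 (hder _)
    rwa [h3.deriv, norm_mul, norm_inv, he, inv_one, mul_one] at h1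

theorem exists_pinched_estimate {S : Set ℂ} (hS : IsOpen S) {α η : ℝ} (hη : 0 < η) {G g : ℂ → ℂ}
    (hG : DifferentiableOn ℂ G leftHalfPlane) (hGi : InjOn G leftHalfPlane)
    (hGm : MapsTo G leftHalfPlane S) (hGj : HasQuadraticJet G α)
    (hg : DifferentiableOn ℂ g S) (hgi : InjOn g S)
    (hgm : MapsTo g S leftHalfPlane) (hgj : HasQuadraticJet g (-α)) :
    ∃ ν > 0, ∃ C, ∀ ζ : ℂ, |ζ.im| < η * ζ.re ^ 2 → -ν < ζ.re → ζ.re < 0 →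
      ζ ∈ S ∧ ∀ m, IsConformallyBounded S ζ m →
        |m - (1 / (2 * ‖ζ‖) + α / 2)| ≤ C * ‖ζ‖ := by
  obtain ⟨K₁, hK₁, h₁⟩ := hGj.exists_inverse_bound
  obtain ⟨K₂, hK₂, h₂⟩ := hgj.exists_bound
  obtain ⟨ν, hν, C, hC⟩ := exists_pinched_bound α (hK₁.trans (le_max_left K₁ K₂)) hη
  obtain ⟨ρ, hρ, hball⟩ := Metric.eventually_nhds_iff.1 (h₁.and h₂)
  -- With t = -Re ζ < 1 the cone gives |ζ| ≤ t + ηt² ≤ (1 + η)t, hence |ζ| < ρ.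
  refine ⟨min ν (min 1 (ρ / (1 + η))), by positivity, C, fun ζ him hre hre0 => ?_⟩
  have hν1 : -ν < ζ.re := by linarith [min_le_left ν (min 1 (ρ / (1 + η)))]
  have hlt1 : -ζ.re < 1 := by
    linarith [(min_le_right ν (min 1 (ρ / (1 + η)))).trans (min_le_left _ _)]
  have hltρ : -ζ.re < ρ / (1 + η) := by
    linarith [(min_le_right ν (min 1 (ρ / (1 + η)))).trans (min_le_right _ _)]
  have hζρ : ‖ζ‖ < ρ := by
    rw [lt_div_iff₀ (by positivity)] at hltρ
    refine (Complex.norm_le_abs_re_add_abs_im ζ).trans_lt ?_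
    rw [abs_of_neg hre0]
    have hsq : ζ.re ^ 2 ≤ -ζ.re := by nlinarith
    have := mul_le_mul_of_nonneg_left hsq hη.le
    linarith
  obtain ⟨⟨ω, hω, hω0, hω1, hω2⟩, hg1, hg2⟩ := hball (y := ζ) (by rwa [dist_zero_right])
  -- This also places `ω` in the half-plane, so ζ = G(ω) lies in `S`.
  have hb1 := hC ζ ω (deriv G ω)⁻¹ him hν1 hre0
    (hω1.trans (by gcongr; exact le_max_left _ _)) (hω2.trans (by gcongr; exact le_max_left _ _))
  have hb2 := hC ζ (g ζ) (deriv g ζ) him hν1 hre0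
    (by
      rw [show ζ - α * ζ ^ 2 = ζ + -α * ζ ^ 2 by ring]
      exact hg1.trans (by gcongr; exact le_max_right _ _))
    (by
      rw [show 1 - 2 * α * ζ = 1 + 2 * -α * ζ by ring]
      exact hg2.trans (by gcongr; exact le_max_right _ _))
  have hζS : ζ ∈ S := hω ▸ hGm hb1.1
  refine ⟨hζS, fun m hm => ?_⟩
  have hup := hm.mul_le_one_of_leftHalfPlane hG hGi hGm hb1.1 hω
  have hlow := hm.norm_deriv_le hS hζS hg hgi hgm
  have hpos1 : 0 < 2 * -ω.re := by linarith [hb1.1]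
  have hpos2 : 0 < 2 * -(g ζ).re := by linarith [hb2.1]
  rw [← div_le_iff₀ hpos2] at hlow
  have hup' : m ≤ ‖(deriv G ω)⁻¹‖ / (2 * -ω.re) := by
    rw [norm_inv, le_div_iff₀ hpos1, ← one_div, le_div_iff₀ (norm_pos_iff.2 hω0), mul_assoc]
    exact hup
  rw [abs_le]
  exact ⟨by linarith [(abs_le.1 hb2.2).1], by linarith [(abs_le.1 hb1.2).2]⟩

/-! ### The cubic chart and the inner map -/

/-- The cubic polynomial `w + α w² + i β w³`. -/
noncomputable def cubicChart (α β : ℝ) (w : ℂ) : ℂ := w + α * w ^ 2 + Complex.I * β * w ^ 3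

theorem hasQuadraticJet_cubicChart (α β : ℝ) : HasQuadraticJet (cubicChart α β) α :=
  ⟨fun _ => Complex.I * β, analyticAt_const, Eventually.of_forall fun w => by
    rw [cubicChart]; ring⟩

theorem differentiable_cubicChart (α β : ℝ) : Differentiable ℂ (cubicChart α β) := by
  unfold cubicChart
  fun_prop

/-- The difference quotient is 1 plus a term of modulus less than 1. -/
theorem injOn_cubicChart {α β δ : ℝ} (hδ : δ * (2 * |α| + 3 * |β|) < 1) (hδ1 : δ ≤ 1) :
    InjOn (cubicChart α β) (Metric.ball 0 δ) := by
  intro w hw u hu h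
  rw [mem_ball_zero_iff] at hw hu
  have hfac : (w - u) * (1 + (α * (w + u) + Complex.I * β * (w ^ 2 + w * u + u ^ 2))) = 0 := by
    rw [cubicChart, cubicChart] at h
    linear_combination h
  rcases mul_eq_zero.1 hfac with h0 | h0
  · exact sub_eq_zero.1 h0
  exfalso
  have h1 : ‖α * (w + u) + Complex.I * β * (w ^ 2 + w * u + u ^ 2)‖ = 1 := by
    rw [eq_neg_of_add_eq_zero_right h0, norm_neg, norm_one]
  have hδ0 : 0 ≤ δ := (norm_nonneg w).trans hw.le
  have h2 : ‖w ^ 2 + w * u + u ^ 2‖ ≤ 3 * δ := by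
    have e1 : ‖w ^ 2‖ ≤ δ := by
      rw [norm_pow, pow_two]; nlinarith [norm_nonneg w]
    have e2 : ‖u ^ 2‖ ≤ δ := by
      rw [norm_pow, pow_two]; nlinarith [norm_nonneg u]
    have e3 : ‖w * u‖ ≤ δ := by
      rw [norm_mul]; nlinarith [norm_nonneg u, norm_nonneg w]
    linarith [norm_add_le (w ^ 2 + w * u) (u ^ 2), norm_add_le (w ^ 2) (w * u)]
  have h3 : ‖w + u‖ ≤ 2 * δ := by linarith [norm_add_le w u]
  have h4 := norm_add_le (α * (w + u)) (Complex.I * β * (w ^ 2 + w * u + u ^ 2))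
  rw [h1, norm_mul, norm_mul, norm_mul, Complex.norm_I, one_mul, Complex.norm_real,
    Complex.norm_real, Real.norm_eq_abs, Real.norm_eq_abs] at h4
  have h5 : |α| * ‖w + u‖ ≤ |α| * (2 * δ) := by gcongr
  have h6 : |β| * ‖w ^ 2 + w * u + u ^ 2‖ ≤ |β| * (3 * δ) := by gcongr
  linarith

theorem one_sub_ne_zero_of_re_neg {a : ℂ} (ha : a.re < 0) : 1 - a ≠ 0 := by
  intro h
  have := congrArg Complex.re h
  simp only [Complex.sub_re, Complex.one_re, Complex.zero_re] at this
  linarith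

theorem re_add_normSq_div_one_sub_neg {a : ℂ} (ha : a.re < 0) :
    (a / (1 - a)).re + Complex.normSq (a / (1 - a)) < 0 := by
  have h0 := Complex.normSq_pos.2 (one_sub_ne_zero_of_re_neg ha)
  have : (a / (1 - a)).re + Complex.normSq (a / (1 - a)) = a.re / Complex.normSq (1 - a) := by
    rw [Complex.normSq_div, Complex.div_re, ← add_div, ← add_div]
    congr 1
    simp only [Complex.normSq_apply, Complex.sub_re, Complex.sub_im, Complex.one_re,
      Complex.one_im]
    ring
  rw [this]
  exact div_neg_of_neg_of_pos ha h0

theorem eq_of_sub_sq_eq_sub_sq {u v : ℂ} (hu : u.re < 0) (hv : v.re < 0)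
    (h : u - u ^ 2 = v - v ^ 2) : u = v := by
  have hfac : (u - v) * (1 - (u + v)) = 0 := by linear_combination h
  rcases mul_eq_zero.1 hfac with h0 | h0
  · exact sub_eq_zero.1 h0
  · have : (u + v).re < 0 := by rw [Complex.add_re]; linarith
    exact absurd h0 (one_sub_ne_zero_of_re_neg this)

theorem div_one_sub_injective {a b : ℂ} (ha : 1 - a ≠ 0) (hb : 1 - b ≠ 0)
    (h : a / (1 - a) = b / (1 - b)) : a = b := by
  rw [div_eq_div_iff ha hb] at h
  linear_combination h

/-- The map is the chart composed with h = (v - v²)/c, v = cω/(1 - cω). Since Re v + |v|² < 0, Re h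
is below -(2/c)(Re v)² ≤ -(2/c)|v|⁴, whereas C|h|⁴ is only of order C|v|⁴/c⁴. -/
theorem exists_inner_map {S : Set ℂ} {α β δ C : ℝ} (hδ : 0 < δ) (hC : 0 ≤ C)
    (hS : ∀ w : ℂ, ‖w‖ < δ → w.re < -(C * ‖w‖ ^ 4) → cubicChart α β w ∈ S) :
    ∃ G : ℂ → ℂ, DifferentiableOn ℂ G leftHalfPlane ∧ InjOn G leftHalfPlane ∧
      MapsTo G leftHalfPlane S ∧ HasQuadraticJet G α := by
  -- In turn: the summand 8C absorbs the quartic error, 4/δ keeps |h| ≤ 2/c below δ, and the last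
  -- makes the chart injective on the ball of radius 3/c.
  obtain ⟨c, hc⟩ : ∃ c : ℝ, c = 4 + 8 * C + 4 / δ + 4 * (2 * |α| + 3 * |β|) := ⟨_, rfl⟩
  have hd0 : 0 < 4 / δ := by positivity
  have hab : 0 ≤ 2 * |α| + 3 * |β| := by positivity
  have hc4 : 4 ≤ c := by linarith
  have hc0 : 0 < c := by linarith
  have hcC : 8 * C ≤ c := by linarith
  have hcδ : 2 / c < δ := by
    rw [div_lt_iff₀ hc0]
    have : 4 / δ ≤ c := by linarith
    rw [div_le_iff₀ hδ] at this
    linarith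
  have hcinj : InjOn (cubicChart α β) (Metric.ball 0 (3 / c)) := by
    refine injOn_cubicChart ?_ ?_
    · rw [div_mul_eq_mul_div, div_lt_one hc0]; linarith
    · rw [div_le_one hc0]; linarith
  have hcne : (c : ℂ) ≠ 0 := by exact_mod_cast hc0.ne'
  have hcre : ∀ ω ∈ leftHalfPlane, ((c : ℂ) * ω).re < 0 := by
    intro ω hω
    rw [Complex.re_ofReal_mul]
    exact mul_neg_of_pos_of_neg hc0 hω
  set v : ℂ → ℂ := fun ω => c * ω / (1 - c * ω) with hv
  set h : ℂ → ℂ := fun ω => (v ω - v ω ^ 2) / c with hh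
  have hvn : ∀ ω ∈ leftHalfPlane, (v ω).re + ‖v ω‖ ^ 2 < 0 := by
    intro ω hω
    rw [← Complex.normSq_eq_norm_sq]
    exact re_add_normSq_div_one_sub_neg (hcre ω hω)
  have hvre : ∀ ω ∈ leftHalfPlane, (v ω).re < 0 := fun ω hω => by
    nlinarith [hvn ω hω, sq_nonneg ‖v ω‖]
  have hv1 : ∀ ω ∈ leftHalfPlane, ‖v ω‖ ≤ 1 := fun ω hω => by
    have h1 := hvn ω hω
    have h2 := Complex.abs_re_le_norm (v ω)
    rw [abs_of_neg (hvre ω hω)] at h2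
    nlinarith [norm_nonneg (v ω)]
  have hhn : ∀ ω ∈ leftHalfPlane, ‖h ω‖ ≤ 2 / c * ‖v ω‖ := by
    intro ω hω
    rw [hh]
    simp only
    rw [norm_div, Complex.norm_real, Real.norm_of_nonneg hc0.le, div_mul_eq_mul_div]
    gcongr
    refine (norm_sub_le _ _).trans ?_
    rw [norm_pow]
    nlinarith [hv1 ω hω, norm_nonneg (v ω)]
  have hhb : ∀ ω ∈ leftHalfPlane, ‖h ω‖ ≤ 2 / c := fun ω hω =>
    (hhn ω hω).trans (mul_le_of_le_one_right (by positivity) (hv1 ω hω))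
  have hhre : ∀ ω ∈ leftHalfPlane, (h ω).re < -(C * ‖h ω‖ ^ 4) := by
    intro ω hω
    have h1 := hvn ω hω
    have h2 := hvre ω hω
    have h3 : (h ω).re = ((v ω).re + ‖v ω‖ ^ 2 - 2 * (v ω).re ^ 2) / c := by
      rw [hh, ← Complex.normSq_eq_norm_sq, Complex.normSq_apply]
      simp only
      rw [Complex.div_ofReal_re, pow_two, Complex.sub_re, Complex.mul_re]
      ring
    have h4 : ‖v ω‖ ^ 4 ≤ (v ω).re ^ 2 := by
      have : ‖v ω‖ ^ 2 ≤ -(v ω).re := by linarith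
      nlinarith [sq_nonneg ‖v ω‖]
    have h5 : C * ‖h ω‖ ^ 4 ≤ 2 / c * ‖v ω‖ ^ 4 := by
      calc C * ‖h ω‖ ^ 4 ≤ C * (2 / c * ‖v ω‖) ^ 4 := by gcongr; exact hhn ω hω
        _ = (8 * C) * (2 / c ^ 4) * ‖v ω‖ ^ 4 := by ring
        _ ≤ c * (2 / c ^ 4) * ‖v ω‖ ^ 4 := by gcongr
        _ = 2 / c ^ 3 * ‖v ω‖ ^ 4 := by field_simp
        _ ≤ 2 / c * ‖v ω‖ ^ 4 := by
          gcongr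
          exact le_self_pow₀ (by linarith) (by norm_num)
    have h6 : (h ω).re < -(2 / c * (v ω).re ^ 2) := by
      rw [h3, div_mul_eq_mul_div, ← neg_div]
      gcongr
      linarith
    have h7 : 2 / c * ‖v ω‖ ^ 4 ≤ 2 / c * (v ω).re ^ 2 := by gcongr
    linarith
  have hvd : DifferentiableOn ℂ v leftHalfPlane := by
    intro ω hω
    have := one_sub_ne_zero_of_re_neg (hcre ω hω)
    refine DifferentiableAt.differentiableWithinAt ?_
    exact DifferentiableAt.div (by fun_prop) (by fun_prop) this
  refine ⟨fun ω => cubicChart α β (h ω), ?_, ?_, ?_, ?_⟩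
  · exact (differentiable_cubicChart α β).comp_differentiableOn ((hvd.sub (hvd.pow 2)).div_const _)
  · intro ω hω ω' hω' heq
    have hlt : 2 / c < 3 / c := by gcongr; norm_num
    have h1 := hcinj (mem_ball_zero_iff.2 ((hhb ω hω).trans_lt hlt))
      (mem_ball_zero_iff.2 ((hhb ω' hω').trans_lt hlt)) heq
    have h2 := eq_of_sub_sq_eq_sub_sq (hvre ω hω) (hvre ω' hω')
      ((div_left_inj' hcne).1 h1)
    exact mul_left_cancel₀ hcne (div_one_sub_injective (one_sub_ne_zero_of_re_neg (hcre ω hω))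
      (one_sub_ne_zero_of_re_neg (hcre ω' hω')) h2)
  · exact fun ω hω => hS _ ((hhb ω hω).trans_lt hcδ) (hhre ω hω)
  -- Exactly h = ω + kω³, so `h` does not change the quadratic jet of the chart.
  · set k : ℂ → ℂ := fun ω => -c ^ 2 / (1 - c * ω) ^ 2 with hk
    refine ⟨fun ω => k ω + α * (2 * k ω * ω + k ω ^ 2 * ω ^ 3)
      + Complex.I * β * (1 + k ω * ω ^ 2) ^ 3, ?_, ?_⟩
    · have hka : AnalyticAt ℂ k 0 :=
        AnalyticAt.div (by fun_prop) (by fun_prop) (by simp)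
      fun_prop
    · have hne : ∀ᶠ ω : ℂ in 𝓝 0, 1 - (c : ℂ) * ω ≠ 0 :=
        ContinuousAt.eventually_ne (by fun_prop) (by simp)
      filter_upwards [hne] with ω hω
      have h1 : h ω = ω + k ω * ω ^ 3 := by
        simp only [hh, hv, hk]
        field_simp
        ring
      rw [h1, cubicChart]
      ring

/-! ### The outer map -/

theorem norm_inv_cubicChart_sub_le {α β : ℝ} {w : ℂ} (hw0 : w ≠ 0) (hw1 : ‖w‖ ≤ 1)
    (hw : ‖w‖ * (|α| + |β|) ≤ 1 / 2) :
    ‖(cubicChart α β w)⁻¹ - (w⁻¹ - α + (α ^ 2 - Complex.I * β) * w)‖ ≤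
      2 * (‖(α * (α ^ 2 - 2 * Complex.I * β) : ℂ)‖ +
        ‖(Complex.I * β * (α ^ 2 - Complex.I * β) : ℂ)‖) * ‖w‖ ^ 2 := by
  set A : ℂ := α * (α ^ 2 - 2 * Complex.I * β) with hA
  set B : ℂ := Complex.I * β * (α ^ 2 - Complex.I * β) with hB
  set u : ℂ := α * w + Complex.I * β * w ^ 2 with hu
  have hun : ‖u‖ ≤ 1 / 2 := by
    refine (norm_add_le _ _).trans ?_
    rw [norm_mul, norm_mul, norm_mul, Complex.norm_I, one_mul, Complex.norm_real,
      Complex.norm_real, Real.norm_eq_abs, Real.norm_eq_abs, norm_pow]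
    have : ‖w‖ ^ 2 ≤ ‖w‖ := by nlinarith [norm_nonneg w]
    have : |β| * ‖w‖ ^ 2 ≤ |β| * ‖w‖ := by gcongr
    linarith
  have h1u : 1 / 2 ≤ ‖1 + u‖ := by
    have := norm_sub_norm_le (1 : ℂ) (-u)
    rw [sub_neg_eq_add, norm_one, norm_neg] at this
    linarith
  have h1u0 : 1 + u ≠ 0 := by
    rw [← norm_pos_iff]; linarith
  have hf : cubicChart α β w = w * (1 + u) := by rw [cubicChart, hu]; ring
  have key : (cubicChart α β w)⁻¹ - (w⁻¹ - α + (α ^ 2 - Complex.I * β) * w) =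
      -((1 + u)⁻¹ * ((A + B * w) * w ^ 2)) := by
    rw [hf, hA, hB]
    field_simp
    rw [hu]
    ring
  rw [key, norm_neg, norm_mul, norm_mul, norm_inv, norm_pow, ← mul_assoc]
  have h2 : ‖1 + u‖⁻¹ ≤ 2 := inv_le_of_inv_le₀ (by norm_num) (by linarith)
  have h3 : ‖A + B * w‖ ≤ ‖A‖ + ‖B‖ := by
    refine (norm_add_le _ _).trans ?_
    rw [norm_mul B w]
    exact add_le_add_right (mul_le_of_le_one_right (norm_nonneg B) hw1) _
  gcongr

/-- The asymptotic behaviour of `T = 1 / ζ + α` for the points `ζ = w + α w² + i β w³` of a set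
that lies on the left of `{Re w ≤ C |w|⁴}`, or its boundedness away from `0`. -/
def IsOuterBounded (β K : ℝ) (T : ℂ) : Prop :=
  ‖T‖ ≤ K ∨ ∃ w : ℂ, w ≠ 0 ∧ ‖w‖ ≤ 1 ∧ T.re ≤ β * w.im + K * ‖w‖ ^ 2 ∧ ‖T - w⁻¹‖ ≤ K * ‖w‖

/-- Near 0, T = 1/w + (α² - iβ)w + O(|w|²). The flattened boundary bounds Re(1/w) by C|w|², and β Im
w is the real part of -iβw. Away from 0 the point 1/ζ is bounded. -/
theorem exists_isOuterBounded {S : Set ℂ} {α β δ C : ℝ} (hδ : 0 < δ) (hC : 0 ≤ C)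
    (h0 : (0 : ℂ) ∉ S)
    (hS : ∀ w : ℂ, ‖w‖ < δ → cubicChart α β w ∈ S → w.re ≤ C * ‖w‖ ^ 4) :
    ∃ K, 0 ≤ K ∧ ∀ ζ ∈ S, IsOuterBounded β K (ζ⁻¹ + α) := by
  have hab : 0 ≤ |α| + |β| := by positivity
  set δ' := min δ (1 / (2 * (1 + |α| + |β|))) with hδ'
  have hδ'0 : 0 < δ' := by positivity
  obtain ⟨δ₁, hδ₁, hball⟩ := Metric.eventually_nhds_iff.1
    ((hasQuadraticJet_cubicChart α β).exists_preimage (Metric.ball_mem_nhds 0 hδ'0))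
  set M := 2 * (‖(α * (α ^ 2 - 2 * Complex.I * β) : ℂ)‖ +
        ‖(Complex.I * β * (α ^ 2 - Complex.I * β) : ℂ)‖) with hM
  have hM0 : 0 ≤ M := by positivity
  set N := ‖(α ^ 2 - Complex.I * β : ℂ)‖ with hN
  have hN0 : 0 ≤ N := norm_nonneg _
  refine ⟨δ₁⁻¹ + |α| + M + N + C + α ^ 2 * C, by positivity, fun ζ hζ => ?_⟩
  have hα2 : 0 ≤ α ^ 2 * C := by positivity
  have hd1 : 0 < δ₁⁻¹ := by positivity
  rcases lt_or_ge ‖ζ‖ δ₁ with h | h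
  · right
    obtain ⟨w, hw, hwζ, -⟩ := hball (y := ζ) (by rwa [dist_zero_right])
    rw [mem_ball_zero_iff] at hw
    have hw0 : w ≠ 0 := by
      rintro rfl
      rw [cubicChart] at hwζ
      simp at hwζ
      exact h0 (hwζ ▸ hζ)
    have hwn : 0 < ‖w‖ := norm_pos_iff.2 hw0
    have hwb : ‖w‖ * (2 * (1 + |α| + |β|)) < 1 := by
      rw [← lt_div_iff₀ (by positivity)]
      exact hw.trans_le (min_le_right _ _)
    have hw1 : ‖w‖ ≤ 1 := by nlinarith
    have hwre := hS w (hw.trans_le (min_le_left _ _)) (hwζ ▸ hζ)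
    have hr := norm_inv_cubicChart_sub_le (α := α) (β := β) hw0 hw1 (by nlinarith)
    rw [hwζ, ← hM] at hr
    obtain ⟨r, hrdef⟩ : ∃ r, r = ζ⁻¹ - (w⁻¹ - α + (α ^ 2 - Complex.I * β) * w) := ⟨_, rfl⟩
    rw [← hrdef] at hr
    have hT : ζ⁻¹ + α = w⁻¹ + (α ^ 2 - Complex.I * β) * w + r := by rw [hrdef]; ring
    have hw2 : ‖w‖ ^ 2 ≤ ‖w‖ := by nlinarith
    have hw4 : ‖w‖ ^ 4 ≤ ‖w‖ ^ 2 := pow_le_pow_of_le_one hwn.le hw1 (by norm_num)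
    refine ⟨w, hw0, hw1, ?_, ?_⟩
    · have e1 : (w⁻¹).re ≤ C * ‖w‖ ^ 2 := by
        rw [Complex.inv_re, Complex.normSq_eq_norm_sq, div_le_iff₀ (by positivity)]
        linarith
      have e2 : ((α ^ 2 - Complex.I * β) * w).re = α ^ 2 * w.re + β * w.im := by
        simp [Complex.mul_re, pow_two]
      have e3 : α ^ 2 * w.re ≤ α ^ 2 * C * ‖w‖ ^ 2 := by
        rw [mul_assoc]
        gcongr
        exact hwre.trans (by gcongr)
      have e4 : r.re ≤ M * ‖w‖ ^ 2 := (Complex.re_le_norm r).trans hr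
      rw [hT, Complex.add_re, Complex.add_re, e2]
      have e5 : 0 ≤ (δ₁⁻¹ + |α| + N) * ‖w‖ ^ 2 := by positivity
      linarith
    · have e1 : ζ⁻¹ + α - w⁻¹ = (α ^ 2 - Complex.I * β) * w + r := by rw [hT]; ring
      rw [e1]
      refine (norm_add_le _ _).trans ?_
      rw [norm_mul, ← hN]
      have e2 : M * ‖w‖ ^ 2 ≤ M * ‖w‖ := by gcongr
      have e3 : 0 ≤ (δ₁⁻¹ + |α| + C + α ^ 2 * C) * ‖w‖ := by positivity
      linarith
  · left
    refine (norm_add_le _ _).trans ?_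
    rw [Complex.norm_real, Real.norm_eq_abs, norm_inv]
    have : ‖ζ‖⁻¹ ≤ δ₁⁻¹ := by gcongr
    linarith

theorem IsOuterBounded.re_le {β K : ℝ} (hK : 0 ≤ K) {T : ℂ} (h : IsOuterBounded β K T) :
    T.re ≤ |β| + K := by
  rcases h with h | ⟨w, -, hw1, h, -⟩
  · linarith [Complex.re_le_norm T, abs_nonneg β]
  · have h1 : β * w.im ≤ |β| := by
      refine (le_abs_self _).trans ?_
      rw [abs_mul]
      exact mul_le_of_le_one_right (abs_nonneg _) ((Complex.abs_im_le_norm w).trans hw1)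
    have h2 : K * ‖w‖ ^ 2 ≤ K :=
      mul_le_of_le_one_right hK (pow_le_one₀ (norm_nonneg _) hw1)
    linarith

theorem re_sub_sq_eq {v : ℂ} (hv : v ≠ 0) :
    (v - v ^ 2).re = ‖v‖ ^ 2 * (1 + (v⁻¹).re) - 2 * v.re ^ 2 := by
  have h0 : Complex.normSq v ≠ 0 := (Complex.normSq_pos.2 hv).ne'
  rw [← Complex.normSq_eq_norm_sq, Complex.inv_re, mul_add, mul_div_cancel₀ _ h0,
    Complex.normSq_apply]
  simp only [pow_two, Complex.sub_re, Complex.mul_re]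
  ring

theorem re_cubic_eq (β c : ℝ) (v : ℂ) :
    (Complex.I * β * v ^ 3 / c ^ 2).re = -(β / c ^ 2 * (v ^ 3).im) := by
  rw [show Complex.I * β * v ^ 3 / c ^ 2 = ((β / c ^ 2 : ℝ) : ℂ) * (Complex.I * v ^ 3) by
    push_cast; ring, Complex.re_ofReal_mul, Complex.I_mul_re]
  ring

/-- Since 1 + Re(1/v) = Re T/c is at most 1/10000, `v` lies in a disk tangent to the axis, where
|v|⁴ ≤ 4(Re v)². The real part in question is |v|²(1 + Re(1/v)) + (β/c²) Im v³ - 2(Re v)², and the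
last term must win. -/
theorem IsOuterBounded.re_neg {β K c : ℝ} (hK : 0 ≤ K) (hc : 10000 * (|β| + K + 1) ≤ c) {T : ℂ}
    (h : IsOuterBounded β K T) {v : ℂ} (hv0 : v ≠ 0) (hv : v⁻¹ = T / c - 1) :
    v.re < 0 ∧ ‖v‖ ≤ 2 ∧ (v - v ^ 2 - Complex.I * β * v ^ 3 / c ^ 2).re < 0 := by
  have hβ := abs_nonneg β
  have hc1 : 10000 ≤ c := by linarith
  have hc0 : 0 < c := by linarith
  have hn0 : 0 < ‖v‖ := norm_pos_iff.2 hv0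
  have hV1 : 1 + (v⁻¹).re = T.re / c := by
    rw [hv, Complex.sub_re, Complex.div_ofReal_re, Complex.one_re]; ring
  have hVε : 1 + (v⁻¹).re ≤ 1 / 10000 := by
    rw [hV1, div_le_iff₀ hc0]
    linarith [h.re_le hK]
  have hre : (v⁻¹).re = v.re / ‖v‖ ^ 2 := by
    rw [Complex.inv_re, Complex.normSq_eq_norm_sq]
  have hx : v.re ≤ -(‖v‖ ^ 2 / 2) := by
    have : v.re / ‖v‖ ^ 2 ≤ -(1 / 2) := by rw [← hre]; linarith
    rw [div_le_iff₀ (by positivity)] at this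
    linarith
  have hx2 : ‖v‖ ^ 4 ≤ 4 * v.re ^ 2 := by nlinarith [sq_nonneg ‖v‖]
  have hneg : v.re < 0 := hx.trans_lt (by simp; positivity)
  have hv2 : ‖v‖ ≤ 2 := by
    have h1 := Complex.abs_re_le_norm v
    rw [abs_of_neg hneg] at h1
    nlinarith
  refine ⟨hneg, hv2, ?_⟩
  rw [Complex.sub_re, re_sub_sq_eq hv0, re_cubic_eq]
  have hcβ : |β| / c ^ 2 ≤ 1 / 10000 := by
    rw [div_le_iff₀ (by positivity)]; nlinarith
  -- For |v| ≥ 1/4 crude bounds suffice: the first two terms total at most 12/10000, while 2(Re v)²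
  -- ≥ |v|⁴/2 ≥ 1/512.
  rcases le_or_gt (1 / 4) ‖v‖ with h4 | h4
  · have e1 : ‖v‖ ^ 2 * (1 + (v⁻¹).re) ≤ 4 * (1 / 10000) := by
      have : ‖v‖ ^ 2 ≤ 4 := by nlinarith
      calc ‖v‖ ^ 2 * (1 + (v⁻¹).re) ≤ ‖v‖ ^ 2 * (1 / 10000) := by gcongr
        _ ≤ _ := by gcongr
    have e2 : β / c ^ 2 * (v ^ 3).im ≤ 1 / 10000 * 8 := by
      refine (le_abs_self _).trans ?_
      rw [abs_mul, abs_div, abs_of_pos (by positivity : 0 < c ^ 2)]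
      gcongr
      refine (Complex.abs_im_le_norm _).trans ?_
      rw [norm_pow]
      calc ‖v‖ ^ 3 ≤ 2 ^ 3 := by gcongr
        _ = 8 := by norm_num
    have e3 : (1 / 4 : ℝ) ^ 4 ≤ ‖v‖ ^ 4 := by gcongr
    norm_num at e3
    linarith
  rcases h with h | ⟨w, hw0, hw1, hw2, hw3⟩
  · exfalso
    have e1 : ‖v⁻¹‖ ≤ 2 := by
      rw [hv]
      refine (norm_sub_le _ _).trans ?_
      rw [norm_div, Complex.norm_real, Real.norm_of_nonneg hc0.le, norm_one]
      have : ‖T‖ / c ≤ 1 := by rw [div_le_one hc0]; linarith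
      linarith
    rw [norm_inv, inv_le_iff_one_le_mul₀ hn0] at e1
    linarith
  have hcne : (c : ℂ) ≠ 0 := by exact_mod_cast hc0.ne'
  -- The rescaled chart coordinate satisfies 1/a = 1/v + 1 + e with |e| ≤ 1, so it agrees with `v`
  -- up to O(|v|²).
  obtain ⟨a, ha⟩ : ∃ a : ℂ, a = c * w := ⟨_, rfl⟩
  have ha0 : a ≠ 0 := by rw [ha]; exact mul_ne_zero hcne hw0
  obtain ⟨e, he⟩ : ∃ e : ℂ, e = -((T - w⁻¹) / c) := ⟨_, rfl⟩
  have hen : ‖e‖ ≤ 1 := by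
    rw [he, norm_neg, norm_div, Complex.norm_real, Real.norm_of_nonneg hc0.le, div_le_one hc0]
    refine hw3.trans ?_
    nlinarith
  have hainv : a⁻¹ = v⁻¹ + 1 + e := by
    rw [hv, he, ha, mul_inv]
    field_simp
    ring
  have hav : v - a = a * (v * (1 + e)) := by
    have h1 : v = a * (v * a⁻¹) := by field_simp
    have h2 : v * a⁻¹ = 1 + v * (1 + e) := by
      rw [hainv]
      field_simp
      ring
    rw [h2] at h1
    linear_combination h1
  have h1e : ‖1 + e‖ ≤ 2 := (norm_add_le _ _).trans (by rw [norm_one]; linarith)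
  have hav1 : ‖v - a‖ ≤ ‖a‖ * (‖v‖ * 2) := by
    rw [hav, norm_mul, norm_mul]
    gcongr
  have han : ‖a‖ ≤ 2 * ‖v‖ := by
    have h1 : ‖a‖ ≤ ‖v‖ + ‖v - a‖ := by
      rw [norm_sub_rev]
      calc ‖a‖ = ‖v + (a - v)‖ := by ring_nf
        _ ≤ _ := norm_add_le _ _
    have h2 : ‖a‖ * (‖v‖ * 2) ≤ ‖a‖ * (1 / 2) := by gcongr; linarith
    linarith
  have hav2 : ‖v - a‖ ≤ 4 * ‖v‖ ^ 2 := by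
    refine hav1.trans ?_
    calc ‖a‖ * (‖v‖ * 2) ≤ 2 * ‖v‖ * (‖v‖ * 2) := by gcongr
      _ = _ := by ring
  -- the cubic terms cancel to leading order
  have hcub : |‖v‖ ^ 2 * a.im + (v ^ 3).im| ≤ 17 * v.re ^ 2 := by
    -- The identity |v|² Im v + Im v³ = 4(Re v)² Im v shows why the cubic term -iβv³/c² is the right
    -- correction.
    have h1 : ‖v‖ ^ 2 * a.im + (v ^ 3).im = 4 * v.re ^ 2 * v.im - ‖v‖ ^ 2 * (v - a).im := by
      rw [← Complex.normSq_eq_norm_sq, Complex.normSq_apply, Complex.sub_im]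
      simp only [pow_succ, pow_zero, one_mul, Complex.mul_im, Complex.mul_re]
      ring
    rw [h1]
    refine (abs_sub _ _).trans ?_
    rw [abs_mul (4 * v.re ^ 2), abs_mul (‖v‖ ^ 2), abs_of_nonneg (by positivity : 0 ≤ 4 * v.re ^ 2),
      abs_of_nonneg (sq_nonneg ‖v‖)]
    have h2 : |v.im| ≤ 1 / 4 := (Complex.abs_im_le_norm v).trans h4.le
    have h3 : |(v - a).im| ≤ 4 * ‖v‖ ^ 2 := (Complex.abs_im_le_norm _).trans hav2
    have h5 : 4 * v.re ^ 2 * |v.im| ≤ 4 * v.re ^ 2 * (1 / 4) := by gcongr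
    have h6 : ‖v‖ ^ 2 * |(v - a).im| ≤ ‖v‖ ^ 2 * (4 * ‖v‖ ^ 2) := by gcongr
    linarith
  have hwa : w.im = a.im / c := by
    rw [ha, Complex.im_ofReal_mul]; field_simp
  have hwn : ‖w‖ = ‖a‖ / c := by
    rw [ha, norm_mul, Complex.norm_real, Real.norm_of_nonneg hc0.le]; field_simp
  have hmain : ‖v‖ ^ 2 * (1 + (v⁻¹).re) ≤
      β / c ^ 2 * (‖v‖ ^ 2 * a.im) + 1 / 10000 * (16 * v.re ^ 2) := by
    have h1 : T.re / c ≤ β / c ^ 2 * a.im + K / c ^ 3 * ‖a‖ ^ 2 := by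
      rw [div_le_iff₀ hc0]
      rw [hwa, hwn] at hw2
      refine hw2.trans (le_of_eq ?_)
      field_simp
    have h2 : K / c ^ 3 ≤ 1 / 10000 := by
      rw [div_le_iff₀ (by positivity)]
      have : c ≤ c ^ 3 := le_self_pow₀ (by linarith) (by norm_num)
      linarith
    have h3 : ‖a‖ ^ 2 ≤ 4 * ‖v‖ ^ 2 := by
      calc ‖a‖ ^ 2 ≤ (2 * ‖v‖) ^ 2 := by gcongr
        _ = _ := by ring
    calc ‖v‖ ^ 2 * (1 + (v⁻¹).re) ≤ ‖v‖ ^ 2 * (β / c ^ 2 * a.im + K / c ^ 3 * ‖a‖ ^ 2) := by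
          rw [hV1]; gcongr
      _ = β / c ^ 2 * (‖v‖ ^ 2 * a.im) + K / c ^ 3 * (‖v‖ ^ 2 * ‖a‖ ^ 2) := by ring
      _ ≤ β / c ^ 2 * (‖v‖ ^ 2 * a.im) + 1 / 10000 * (‖v‖ ^ 2 * (4 * ‖v‖ ^ 2)) := by gcongr
      _ ≤ _ := by linarith
  have hβ17 : β / c ^ 2 * (‖v‖ ^ 2 * a.im + (v ^ 3).im) ≤ 1 / 10000 * (17 * v.re ^ 2) := by
    refine (le_abs_self _).trans ?_
    rw [abs_mul, abs_div, abs_of_pos (by positivity : 0 < c ^ 2)]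
    gcongr
  have hxpos : 0 < v.re ^ 2 := by have := hneg.ne; positivity
  linarith

theorem injOn_cubic {b : ℝ} (hb : |b| * 12 < 1) :
    InjOn (fun v : ℂ => v - v ^ 2 - Complex.I * b * v ^ 3) {v | v.re < 0 ∧ ‖v‖ ≤ 2} := by
  rintro u ⟨hu, hu2⟩ v ⟨hv, hv2⟩ h
  have hfac : (u - v) * (1 - (u + v) - Complex.I * b * (u ^ 2 + u * v + v ^ 2)) = 0 := by
    simp only at h
    linear_combination h
  rcases mul_eq_zero.1 hfac with h0 | h0
  · exact sub_eq_zero.1 h0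
  exfalso
  have h1 := congrArg Complex.re h0
  rw [Complex.sub_re, Complex.sub_re, Complex.one_re, Complex.add_re, Complex.zero_re] at h1
  have h2 : (Complex.I * b * (u ^ 2 + u * v + v ^ 2)).re ≤ |b| * 12 := by
    refine (Complex.re_le_norm _).trans ?_
    rw [norm_mul, norm_mul, Complex.norm_I, one_mul, Complex.norm_real, Real.norm_eq_abs]
    gcongr
    have e1 : ‖u ^ 2‖ ≤ 4 := by rw [norm_pow]; nlinarith [norm_nonneg u]
    have e2 : ‖v ^ 2‖ ≤ 4 := by rw [norm_pow]; nlinarith [norm_nonneg v]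
    have e3 : ‖u * v‖ ≤ 4 := by rw [norm_mul]; nlinarith [norm_nonneg u, norm_nonneg v]
    linarith [norm_add_le (u ^ 2 + u * v) (v ^ 2), norm_add_le (u ^ 2) (u * v)]
  linarith

/-- The Möbius map contributes m to the second-order coefficient and the square contributes -c; the
cubic term affects only the remainder. -/
theorem outer_expansion {c m b ζ : ℂ} (hc : c ≠ 0) (h : 1 - m * ζ ≠ 0) :
    (c * ζ / (1 - m * ζ) - (c * ζ / (1 - m * ζ)) ^ 2 -
      Complex.I * b * (c * ζ / (1 - m * ζ)) ^ 3 / c ^ 2) / c =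
    ζ + -(c - m) * ζ ^ 2 + ζ ^ 3 * ((-m ^ 2 - 2 * (c - m) * m + (c - m) * m ^ 2 * ζ) /
      (1 - m * ζ) ^ 2 - Complex.I * b / (1 - m * ζ) ^ 3) := by
  obtain ⟨d, hd⟩ : ∃ d, d = 1 - m * ζ := ⟨_, rfl⟩
  rw [← hd] at h ⊢
  field_simp
  rw [hd]
  ring

theorem exists_outer_map {S : Set ℂ} {α β δ C : ℝ} (hδ : 0 < δ) (hC : 0 ≤ C)
    (h0 : (0 : ℂ) ∉ S)
    (hS : ∀ w : ℂ, ‖w‖ < δ → cubicChart α β w ∈ S → w.re ≤ C * ‖w‖ ^ 4) :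
    ∃ g : ℂ → ℂ, DifferentiableOn ℂ g S ∧ InjOn g S ∧ MapsTo g S leftHalfPlane ∧
      HasQuadraticJet g (-α) := by
  obtain ⟨K, hK, hT⟩ := exists_isOuterBounded hδ hC h0 hS
  obtain ⟨c, hc⟩ : ∃ c : ℝ, c = 10000 * (|β| + K + 1) := ⟨_, rfl⟩
  have hβ := abs_nonneg β
  have hc1 : 10000 ≤ c := by linarith
  have hc0 : 0 < c := by linarith
  have hcne : (c : ℂ) ≠ 0 := by exact_mod_cast hc0.ne'
  set v : ℂ → ℂ := fun ζ => c * ζ / (1 - (c - α) * ζ) with hv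
  have hζ0 : ∀ ζ ∈ S, ζ ≠ 0 := fun ζ hζ h => h0 (h ▸ hζ)
  -- A pole would mean T = c, but Re T ≤ |β| + K < c.
  have hden : ∀ ζ ∈ S, 1 - (c - α) * ζ ≠ 0 := by
    intro ζ hζ h
    have h1 := (hT ζ hζ).re_le hK
    have h2 : ζ⁻¹ + α = c := by
      have := hζ0 ζ hζ
      field_simp
      linear_combination h
    rw [h2, Complex.ofReal_re] at h1
    linarith
  have hv0 : ∀ ζ ∈ S, v ζ ≠ 0 := fun ζ hζ =>
    div_ne_zero (mul_ne_zero hcne (hζ0 ζ hζ)) (hden ζ hζ)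
  have hvinv : ∀ ζ ∈ S, (v ζ)⁻¹ = (ζ⁻¹ + α) / c - 1 := by
    intro ζ hζ
    have := hζ0 ζ hζ
    simp only [hv]
    rw [inv_div]
    field_simp
    ring
  have hmain := fun ζ hζ => (hT ζ hζ).re_neg hK hc.ge (hv0 ζ hζ) (hvinv ζ hζ)
  have hvd : DifferentiableOn ℂ v S := by
    intro ζ hζ
    refine DifferentiableAt.differentiableWithinAt ?_
    exact DifferentiableAt.div (by fun_prop) (by fun_prop) (hden ζ hζ)
  have hb : |β / c ^ 2| * 12 < 1 := by
    rw [abs_div, abs_of_pos (by positivity : 0 < c ^ 2), div_mul_eq_mul_div,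
      div_lt_one (by positivity)]
    nlinarith
  have hcast : ∀ x : ℂ, Complex.I * ((β / c ^ 2 : ℝ) : ℂ) * x ^ 3 =
      Complex.I * β * x ^ 3 / c ^ 2 := fun x => by push_cast; ring
  have hinj := injOn_cubic hb
  simp only [hcast] at hinj
  refine ⟨fun ζ => (v ζ - v ζ ^ 2 - Complex.I * β * v ζ ^ 3 / c ^ 2) / c, ?_, ?_, ?_, ?_⟩
  · exact ((hvd.sub (hvd.pow 2)).sub (((hvd.pow 3).const_mul _).div_const _)).div_const _
  · intro ζ hζ ζ' hζ' heq
    have h1 := hinj ⟨(hmain ζ hζ).1, (hmain ζ hζ).2.1⟩ ⟨(hmain ζ' hζ').1, (hmain ζ' hζ').2.1⟩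
      ((div_left_inj' hcne).1 heq)
    have h2 := congrArg Inv.inv h1
    rw [hvinv ζ hζ, hvinv ζ' hζ', sub_left_inj, div_left_inj' hcne, add_left_inj] at h2
    exact inv_injective h2
  · intro ζ hζ
    show Complex.re (_ / _) < 0
    rw [Complex.div_ofReal_re]
    exact div_neg_of_neg_of_pos (hmain ζ hζ).2.2 hc0
  · refine ⟨fun ζ => (-(c - α) ^ 2 - 2 * α * (c - α) + α * (c - α) ^ 2 * ζ) /
      (1 - (c - α) * ζ) ^ 2 - Complex.I * β / (1 - (c - α) * ζ) ^ 3, ?_, ?_⟩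
    · have h1 : AnalyticAt ℂ (fun ζ : ℂ => (1 - (c - α) * ζ) ^ 2) 0 := by fun_prop
      have h2 : AnalyticAt ℂ (fun ζ : ℂ => (1 - (c - α) * ζ) ^ 3) 0 := by fun_prop
      exact (AnalyticAt.div (by fun_prop) h1 (by simp)).sub
        (AnalyticAt.div (by fun_prop) h2 (by simp))
    · have hne : ∀ᶠ ζ : ℂ in 𝓝 0, 1 - (c - α : ℂ) * ζ ≠ 0 :=
        ContinuousAt.eventually_ne (by fun_prop) (by simp)
      filter_upwards [hne] with ζ hζ
      have h := outer_expansion (b := β) hcne hζ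
      rw [sub_sub_cancel] at h
      exact h

/-! ### Flattening the boundary to fourth order -/

theorem ContDiffAt.isBigO_sub_taylor {u : ℝ → ℝ} {n : ℕ} (h : ContDiffAt ℝ n u 0) :
    (fun y => u y - ∑ k ∈ Finset.range n, (k.factorial : ℝ)⁻¹ * y ^ k * iteratedDeriv k u 0)
      =O[𝓝 0] fun y : ℝ => y ^ n := by
  obtain ⟨t, ht, hu⟩ := h.contDiffOn le_rfl (by simp)
  obtain ⟨r, hr, hrt⟩ := Metric.nhds_basis_ball.mem_iff.1 ht
  have hmem : (0 : ℝ) ∈ Metric.ball (0 : ℝ) r := Metric.mem_ball_self hr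
  have h1 := taylor_isLittleO (convex_ball (0 : ℝ) r) hmem (hu.mono hrt)
  rw [Metric.isOpen_ball.nhdsWithin_eq hmem] at h1
  simp only [sub_zero] at h1
  have h2 : (fun y : ℝ => (n.factorial : ℝ)⁻¹ * y ^ n * iteratedDeriv n u 0)
      =O[𝓝 0] fun y : ℝ => y ^ n := by
    simp_rw [mul_comm _ (iteratedDeriv n u 0), ← mul_assoc]
    exact (Asymptotics.isBigO_refl _ _).const_mul_left _
  refine (h1.isBigO.add h2).congr_left fun y => ?_
  rw [taylor_within_apply, Finset.sum_range_succ]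
  simp only [sub_zero, smul_eq_mul,
    iteratedDerivWithin_of_isOpen Metric.isOpen_ball hmem]
  ring

/-- The derivative is locally Lipschitz. Uniformity in the base point is needed because it will move
along the tangent line. -/
theorem ContDiffAt.exists_norm_sub_sub_le {E : Type*} [NormedAddCommGroup E] [NormedSpace ℝ E]
    {f : E → ℝ} {x : E} (h : ContDiffAt ℝ 2 f x) :
    ∃ K, ∀ᶠ q : E × E in 𝓝 (x, 0), |f (q.1 + q.2) - f q.1 - fderiv ℝ f q.1 q.2| ≤ K * ‖q.2‖ ^ 2 := by
  obtain ⟨K, t, ht, hK⟩ := (h.fderiv_right (m := 1) (by norm_num)).exists_lipschitzOnWith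
  have hd : ∀ᶠ y in 𝓝 x, DifferentiableAt ℝ f y :=
    (h.eventually (by simp)).mono fun y hy => hy.differentiableAt (by simp)
  obtain ⟨r, hr, hball⟩ := Metric.nhds_basis_ball.mem_iff.1 (inter_mem ht hd)
  refine ⟨K, ?_⟩
  have h1 : ∀ᶠ q : E × E in 𝓝 (x, 0), q.1 ∈ Metric.ball x r ∧ q.1 + q.2 ∈ Metric.ball x r := by
    have c1 : ContinuousAt (fun q : E × E => q.1) (x, 0) := by fun_prop
    have c2 : ContinuousAt (fun q : E × E => q.1 + q.2) (x, 0) := by fun_prop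
    exact (c1.eventually_mem (Metric.ball_mem_nhds x hr)).and
      (c2.eventually_mem (by simpa using Metric.ball_mem_nhds x hr))
  filter_upwards [h1] with q hq
  have hseg := (convex_ball x r).segment_subset hq.1 hq.2
  have := (convex_segment q.1 (q.1 + q.2)).norm_image_sub_le_of_norm_fderiv_le' (𝕜 := ℝ) (f := f)
    (φ := fderiv ℝ f q.1) (C := K * ‖q.2‖) (fun y hy => (hball (hseg hy)).2)
    (fun y hy => by
      refine (hK.norm_sub_le (hball (hseg hy)).1 (hball hq.1).1).trans ?_
      gcongr
      obtain ⟨a, ha, rfl⟩ := (segment_eq_image' ℝ q.1 (q.1 + q.2)) ▸ hy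
      simp only [add_sub_cancel_left, norm_smul, Real.norm_of_nonneg ha.1]
      exact mul_le_of_le_one_left (norm_nonneg _) ha.2)
    (left_mem_segment ℝ _ _) (right_mem_segment ℝ _ _)
  rw [add_sub_cancel_left, mul_assoc, ← pow_two] at this
  exact this

theorem IsLocalDefiningFunction.eq_zero {k : ℕ} {D : Set ℂ} (hD : IsOpen D) {p : ℂ}
    (hp : p ∈ frontier D) {U : Set ℂ} {φ : ℂ → ℝ} (hφ : IsLocalDefiningFunction k D p U φ) :
    φ p = 0 := by
  have hcont : ContinuousAt φ p :=
    (hφ.contDiffOn.continuousOn).continuousAt (hφ.isOpen.mem_nhds hφ.mem)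
  rcases lt_trichotomy (φ p) 0 with h | h | h
  · have : p ∈ D ∩ U := by
      rw [hφ.inter_eq]
      exact ⟨hφ.mem, h⟩
    rw [hD.frontier_eq] at hp
    exact absurd this.1 hp.2
  · exact h
  · exfalso
    have h1 : ∀ᶠ z in 𝓝 p, 0 < φ z ∧ z ∈ U :=
      (hcont.eventually_const_lt h).and (hφ.isOpen.mem_nhds hφ.mem)
    obtain ⟨z, hz, hzD⟩ := mem_closure_iff_nhds.1 (frontier_subset_closure hp) _ h1
    have : z ∈ D ∩ U := ⟨hzD, hz.2⟩
    rw [hφ.inter_eq] at this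
    exact lt_asymm this.2 hz.1

theorem fderiv_mul_outwardUnitNormal {φ : ℂ → ℝ} {p : ℂ} (h : gradient φ p ≠ 0) (v : ℂ) :
    fderiv ℝ φ p (outwardUnitNormal φ p * v) = ‖gradient φ p‖ * v.re := by
  have h1 : fderiv ℝ φ p (outwardUnitNormal φ p * v) =
      inner ℝ (gradient φ p) (outwardUnitNormal φ p * v) := by
    rw [← toDual_gradient, InnerProductSpace.toDual_apply_apply]
  have h0 : (‖gradient φ p‖ : ℂ) ≠ 0 := by simpa using h
  rw [h1, Complex.inner, outwardUnitNormal]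
  have : gradient φ p / ‖gradient φ p‖ * v * (starRingEnd ℂ) (gradient φ p) =
      ((‖gradient φ p‖ : ℝ) : ℂ) * v := by
    field_simp
    rw [mul_assoc, mul_comm v, ← mul_assoc, Complex.mul_conj']
  rw [this, Complex.re_ofReal_mul]

theorem realHessian_smul (φ : ℂ → ℝ) (p v : ℂ) (r : ℝ) :
    realHessian φ p (r * v) = r ^ 2 * realHessian φ p v := by
  rw [realHessian, realHessian, ← Complex.real_smul, map_smul, map_smul]
  simp only [smul_apply, smul_eq_mul]
  ring

theorem realHessian_outwardUnitNormal {φ : ℂ → ℝ} {p : ℂ} (h : gradient φ p ≠ 0) :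
    realHessian φ p (outwardUnitNormal φ p * Complex.I) =
      boundaryCurvature φ p * ‖gradient φ p‖ := by
  have h0 : ‖gradient φ p‖ ≠ 0 := norm_ne_zero_iff.2 h
  have h1 : Complex.I * gradient φ p =
      (‖gradient φ p‖ : ℝ) * (outwardUnitNormal φ p * Complex.I) := by
    have : (‖gradient φ p‖ : ℂ) ≠ 0 := by exact_mod_cast h0
    rw [outwardUnitNormal]
    field_simp
  rw [boundaryCurvature, h1, realHessian_smul]
  field_simp

theorem exists_normal_tangential_expansion {φ : ℂ → ℝ} {p e : ℂ} {γ κ : ℝ}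
    (hφ : ContDiffAt ℝ 4 φ p) (h0 : φ p = 0)
    (h1 : ∀ v, fderiv ℝ φ p (e * v) = γ * v.re) (hκ : realHessian φ p (e * Complex.I) = κ * γ) :
    ∃ a b : ℝ, ((fun y : ℝ => φ (p + e * (y * Complex.I)) - (κ * γ / 2 * y ^ 2 + a * y ^ 3))
        =O[𝓝 0] fun y : ℝ => y ^ 4) ∧
      ((fun y : ℝ => fderiv ℝ φ (p + e * (y * Complex.I)) e - (γ + b * y))
        =O[𝓝 0] fun y : ℝ => y ^ 2) := by
  set ℓ : ℝ → ℂ := fun y => p + e * (y * Complex.I) with hℓ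
  have hℓ0 : ℓ 0 = p := by simp [hℓ]
  have hℓd : ∀ y, HasDerivAt ℓ (e * Complex.I) y := by
    intro y
    have := (((Complex.ofRealCLM.hasDerivAt (x := y)).mul_const Complex.I).const_mul e).const_add p
    simpa [hℓ] using this
  have hℓc : ContDiff ℝ 4 ℓ := by
    have : ContDiff ℝ 4 (fun y : ℝ => (y : ℂ)) := Complex.ofRealCLM.contDiff
    exact contDiff_const.add (contDiff_const.mul (this.mul contDiff_const))
  have hφℓ : ContDiffAt ℝ 4 φ (ℓ 0) := by rwa [hℓ0]
  have hu : ContDiffAt ℝ (4 : ℕ) (fun y => φ (ℓ y)) 0 := hφℓ.comp 0 hℓc.contDiffAt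
  have hq : ContDiffAt ℝ (2 : ℕ) (fun y => fderiv ℝ φ (ℓ y) e) 0 := by
    have h2 : ContDiffAt ℝ 2 (fderiv ℝ φ) (ℓ 0) := hφℓ.fderiv_right (by norm_num)
    exact (h2.comp 0 (hℓc.contDiffAt.of_le (by norm_num))).clm_apply contDiffAt_const
  have hdu : ∀ᶠ y in 𝓝 0, deriv (fun y => φ (ℓ y)) y = fderiv ℝ φ (ℓ y) (e * Complex.I) := by
    have : ∀ᶠ z in 𝓝 (ℓ 0), DifferentiableAt ℝ φ z :=
      (hφℓ.eventually (by simp)).mono fun z hz => hz.differentiableAt (by simp)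
    filter_upwards [(hℓd 0).continuousAt.eventually this] with y hy
    exact (hy.hasFDerivAt.comp_hasDerivAt y (hℓd y)).deriv
  have hu1 : deriv (fun y => φ (ℓ y)) 0 = 0 := by
    rw [hdu.self_of_nhds, hℓ0, h1]; simp
  have hu2 : deriv (deriv fun y => φ (ℓ y)) 0 = κ * γ := by
    rw [EventuallyEq.deriv_eq hdu, ← hκ, realHessian]
    have h2 : DifferentiableAt ℝ (fderiv ℝ φ) (ℓ 0) :=
      (hφℓ.fderiv_right (m := 1) (by norm_num)).differentiableAt (by simp)
    have h3 := h2.hasFDerivAt.comp_hasDerivAt 0 (hℓd 0)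
    have h4 := h3.clm_apply (hasDerivAt_const 0 (e * Complex.I))
    rw [hℓ0] at h4
    refine h4.deriv.trans ?_
    simp
  refine ⟨6⁻¹ * iteratedDeriv 3 (fun y => φ (ℓ y)) 0,
    iteratedDeriv 1 (fun y => fderiv ℝ φ (ℓ y) e) 0, ?_, ?_⟩
  · refine hu.isBigO_sub_taylor.congr_left fun y => ?_
    simp only [Finset.sum_range_succ, Finset.sum_range_zero, iteratedDeriv_zero, iteratedDeriv_one,
      hu1, iteratedDeriv_succ (n := 1), hu2, hℓ0, h0, Nat.factorial]
    norm_num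
    ring
  · refine hq.isBigO_sub_taylor.congr_left fun y => ?_
    have h2 : fderiv ℝ φ p e = γ := by simpa using h1 1
    simp only [Finset.sum_range_succ, Finset.sum_range_zero, iteratedDeriv_zero, hℓ0, h2,
      Nat.factorial]
    norm_num
    ring

/-- On the imaginary axis the chart is iy plus the real displacement h = -(κ/2)y² + βy³. Expanding
`φ` in the normal direction from the tangent line leaves an O(h²) = O(y⁴) error; the y² terms cancel
by the choice κ/2, and β is free to cancel the y³ terms. -/
theorem exists_cubicChart_isBigO {φ : ℂ → ℝ} {p e : ℂ} {γ κ : ℝ} (hγ : γ ≠ 0)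
    (hφ : ContDiffAt ℝ 4 φ p) (h0 : φ p = 0)
    (h1 : ∀ v, fderiv ℝ φ p (e * v) = γ * v.re) (hκ : realHessian φ p (e * Complex.I) = κ * γ) :
    ∃ β : ℝ, (fun y : ℝ => φ (p + e * cubicChart (κ / 2) β (y * Complex.I)))
      =O[𝓝 0] fun y : ℝ => y ^ 4 := by
  obtain ⟨a, b, ha, hb⟩ := exists_normal_tangential_expansion hφ h0 h1 hκ
  obtain ⟨K, hK⟩ := (hφ.of_le (by norm_num : (2 : WithTop ℕ∞) ≤ 4)).exists_norm_sub_sub_le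
  -- The y³ coefficient is a + γβ - bκ/2.
  obtain ⟨β, hβ⟩ : ∃ β : ℝ, γ * β = b * (κ / 2) - a := ⟨(b * (κ / 2) - a) / γ, by field_simp⟩
  refine ⟨β, ?_⟩
  set h : ℝ → ℝ := fun y => -(κ / 2) * y ^ 2 + β * y ^ 3 with hh
  have hbound : ∀ {m : ℕ} (n : ℕ), m ≤ n → (fun y : ℝ => y ^ n) =O[𝓝 0] fun y : ℝ => y ^ m :=
    fun n hmn => by
    refine Asymptotics.IsBigO.of_bound 1 ?_
    filter_upwards [Metric.closedBall_mem_nhds (0 : ℝ) one_pos] with y hy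
    rw [mem_closedBall_zero_iff] at hy
    rw [norm_pow, norm_pow, one_mul]
    exact pow_le_pow_of_le_one (norm_nonneg _) hy hmn
  have hh2 : h =O[𝓝 0] fun y : ℝ => y ^ 2 :=
    ((Asymptotics.isBigO_refl _ _).const_mul_left _).add
      ((hbound 3 (by norm_num)).const_mul_left _)
  have hchart : ∀ y : ℝ, cubicChart (κ / 2) β (y * Complex.I) = y * Complex.I + (h y : ℝ) := by
    intro y
    rw [cubicChart, hh]
    push_cast
    linear_combination ((κ / 2) * y ^ 2 + β * y ^ 3 * (Complex.I ^ 2 - 1)) * Complex.I_sq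
  have hrem : (fun y : ℝ => φ (p + e * cubicChart (κ / 2) β (y * Complex.I)) -
      φ (p + e * (y * Complex.I)) - h y * fderiv ℝ φ (p + e * (y * Complex.I)) e)
      =O[𝓝 0] fun y : ℝ => y ^ 4 := by
    have e1 : (fun y : ℝ => φ (p + e * cubicChart (κ / 2) β (y * Complex.I)) -
        φ (p + e * (y * Complex.I)) - h y * fderiv ℝ φ (p + e * (y * Complex.I)) e)
        =O[𝓝 0] fun y : ℝ => ‖e * (h y : ℂ)‖ ^ 2 := by
      refine Asymptotics.IsBigO.of_bound K ?_
      have c1 : ContinuousAt (fun y : ℝ => (p + e * (y * Complex.I), e * (h y : ℂ))) 0 := by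
        have : Continuous h := by fun_prop
        fun_prop
      have hz : (p + e * (((0 : ℝ) : ℂ) * Complex.I), e * (h 0 : ℂ)) = (p, (0 : ℂ)) := by
        simp [hh]
      rw [ContinuousAt, hz] at c1
      filter_upwards [c1.eventually hK] with y hy
      rw [Real.norm_eq_abs, norm_pow, norm_norm, hchart, mul_add, ← add_assoc]
      have e2 : fderiv ℝ φ (p + e * (y * Complex.I)) (e * (h y : ℂ)) =
          h y * fderiv ℝ φ (p + e * (y * Complex.I)) e := by
        have : e * (h y : ℂ) = h y • e := by rw [Complex.real_smul, mul_comm]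
        rw [this, map_smul, smul_eq_mul]
      rw [← e2]
      exact hy
    refine e1.trans ?_
    have e3 : (fun y : ℝ => ‖e * (h y : ℂ)‖) =O[𝓝 0] fun y : ℝ => y ^ 2 := by
      simp_rw [norm_mul, Complex.norm_real]
      exact hh2.norm_left.const_mul_left _
    refine (e3.pow 2).congr_right fun y => by ring
  have hprod : (fun y : ℝ => h y * (fderiv ℝ φ (p + e * (y * Complex.I)) e - (γ + b * y)))
      =O[𝓝 0] fun y : ℝ => y ^ 4 :=
    (hh2.mul hb).congr_right fun y => by ring
  have hpoly : (fun y : ℝ => b * β * y ^ 4) =O[𝓝 0] fun y : ℝ => y ^ 4 :=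
    (Asymptotics.isBigO_refl _ _).const_mul_left _
  refine (((hrem.add ha).add hprod).add hpoly).congr_left fun y => ?_
  simp only [hh]
  linear_combination -y ^ 3 * hβ

/-- In the chart, φ(w) differs from φ(i Im w) = O(|w|⁴) by γ Re w up to half its size, so the sign
of `φ` is that of Re w once |Re w| > (2C/γ)|w|⁴. -/
theorem exists_cubicChart_graph_bounds {D U : Set ℂ} {φ : ℂ → ℝ} {p e : ℂ} {γ κ : ℝ}
    (hφ : IsLocalDefiningFunction 4 D p U φ) (hγ : 0 < γ) (h0 : φ p = 0)
    (h1 : ∀ v, fderiv ℝ φ p (e * v) = γ * v.re) (hκ : realHessian φ p (e * Complex.I) = κ * γ) :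
    ∃ β δ C : ℝ, 0 < δ ∧ 0 ≤ C ∧
      (∀ w : ℂ, ‖w‖ < δ → w.re < -(C * ‖w‖ ^ 4) → p + e * cubicChart (κ / 2) β w ∈ D) ∧
      ∀ w : ℂ, ‖w‖ < δ → p + e * cubicChart (κ / 2) β w ∈ D → w.re ≤ C * ‖w‖ ^ 4 := by
  have hφp : ContDiffAt ℝ 4 φ p := hφ.contDiffOn.contDiffAt (hφ.isOpen.mem_nhds hφ.mem)
  obtain ⟨β, hβ⟩ := exists_cubicChart_isBigO hγ.ne' hφp h0 h1 hκ
  obtain ⟨C, hC, hCb⟩ := hβ.exists_nonneg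
  set Ψ : ℂ → ℝ := fun w => φ (p + e * cubicChart (κ / 2) β w) with hΨ
  have hc0 : p + e * cubicChart (κ / 2) β 0 = p := by simp [cubicChart]
  have hstrict : HasStrictFDerivAt Ψ (γ • Complex.reCLM) 0 := by
    have e1 : HasStrictFDerivAt (fun w => p + e * cubicChart (κ / 2) β w)
        ((ContinuousLinearMap.toSpanSingleton ℂ e).restrictScalars ℝ) 0 := by
      have := ((hasQuadraticJet_cubicChart (κ / 2) β).hasStrictDerivAt.const_mul e).const_add p
      rw [mul_one] at this
      convert! this.hasStrictFDerivAt.restrictScalars ℝ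
    have e2 : HasStrictFDerivAt φ (fderiv ℝ φ p) (p + e * cubicChart (κ / 2) β 0) := by
      rw [hc0]
      exact hφp.hasStrictFDerivAt (by simp)
    refine (e2.comp 0 e1).congr_fderiv ?_
    ext v
    simp [mul_comm v e, h1]
  have hcont : ContinuousAt (fun w => p + e * cubicChart (κ / 2) β w) 0 :=
    ((differentiable_cubicChart (κ / 2) β).continuous.const_mul e |>.const_add p).continuousAt
  have hU : ∀ᶠ w in 𝓝 (0 : ℂ), p + e * cubicChart (κ / 2) β w ∈ U :=
    hcont.eventually_mem (by rw [hc0]; exact hφ.isOpen.mem_nhds hφ.mem)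
  have him : ContinuousAt (fun w : ℂ => (w, (w.im * Complex.I : ℂ))) 0 := by fun_prop
  -- Strict differentiability is what allows comparing two moving points, w and i Im w, with error
  -- proportional to their distance |Re w|.
  have hvert : ∀ᶠ w in 𝓝 (0 : ℂ), |Ψ w - Ψ (w.im * Complex.I) - γ * w.re| ≤ γ / 2 * |w.re| := by
    have e1 := hstrict.isLittleO.bound (half_pos hγ)
    rw [ContinuousAt] at him
    simp only [Complex.zero_im, Complex.ofReal_zero, zero_mul] at him
    filter_upwards [him.eventually e1] with w hw
    have e2 : w - w.im * Complex.I = w.re := by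
      linear_combination -Complex.re_add_im w
    simp only [e2, Complex.norm_real, Real.norm_eq_abs] at hw
    simpa using hw
  have hΨim : ∀ᶠ w in 𝓝 (0 : ℂ), |Ψ (w.im * Complex.I)| ≤ C * ‖w‖ ^ 4 := by
    have e1 : Tendsto Complex.im (𝓝 0) (𝓝 0) := Complex.continuous_im.tendsto' _ _ rfl
    filter_upwards [e1.eventually hCb.bound] with w hw
    refine hw.trans ?_
    rw [norm_pow, Real.norm_eq_abs]
    gcongr
    exact Complex.abs_im_le_norm w
  obtain ⟨δ, hδ, hball⟩ := Metric.eventually_nhds_iff.1 (hU.and (hvert.and hΨim))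
  have hmem : ∀ z, z ∈ U → (z ∈ D ↔ φ z < 0) := fun z hz => by
    have := hφ.inter_eq
    constructor
    · intro h
      have h2 : z ∈ D ∩ U := ⟨h, hz⟩
      rw [this] at h2
      exact h2.2
    · intro h
      have h2 : z ∈ {z ∈ U | φ z < 0} := ⟨hz, h⟩
      rw [← this] at h2
      exact h2.1
  have hscale : ∀ t : ℝ, γ / 2 * (2 * C / γ * t) = C * t := fun t => by field_simp
  refine ⟨β, δ, 2 * C / γ, hδ, by positivity, fun w hw hre => ?_, fun w hw hD => ?_⟩
  · obtain ⟨hwU, hv, hi⟩ := hball (y := w) (by rwa [dist_zero_right])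
    rw [hmem _ hwU]
    have hneg : w.re < 0 := hre.trans_le (by simp; positivity)
    rw [abs_of_neg hneg] at hv
    have e1 := (abs_le.1 hv).2
    have e2 := (abs_le.1 hi).2
    have e3 := mul_lt_mul_of_pos_left hre (half_pos hγ)
    rw [mul_neg, hscale] at e3
    show Ψ w < 0
    linarith
  · obtain ⟨hwU, hv, hi⟩ := hball (y := w) (by rwa [dist_zero_right])
    rw [hmem _ hwU] at hD
    have hD' : Ψ w < 0 := hD
    rcases le_or_gt w.re 0 with hneg | hpos
    · exact hneg.trans (by positivity)
    rw [abs_of_pos hpos] at hv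
    have e1 := (abs_le.1 hv).1
    have e2 := (abs_le.1 hi).1
    refine le_of_mul_le_mul_left ?_ (half_pos hγ)
    rw [hscale]
    linarith

/-! ### Assembly -/

theorem mainTheorem6 (D : Set ℂ) (hD : IsPlanarDomainOfClass 4 D)
    (p : ℂ) (hp : p ∈ frontier D)
    (U : Set ℂ) (φ : ℂ → ℝ) (hφ : IsLocalDefiningFunction 4 D p U φ)
    (θ : ℝ) (hθ : Complex.exp (θ * Complex.I) = outwardUnitNormal φ p)
    (η : ℝ) (hη : 0 < η) :
    ∃ ν : ℝ, 0 < ν ∧ pinchedCone θ p η ν ⊆ D ∧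
      ∃ C : ℝ,
        (∀ F : Set ℂ → ℂ → ℂ → ℝ, IsInvariantMetric F →
          ∀ z ∈ pinchedCone θ p η ν,
            |F D z 1 - (1 / (2 * ‖z - p‖) + boundaryCurvature φ p / 4)| ≤ C * ‖z - p‖) ∧
        ∃ B : ℂ → ℂ → ℂ, IsBergmanKernel D B ∧
          ∀ z ∈ pinchedCone θ p η ν,
            |Real.sqrt (Real.pi * (B z z).re) -
              (1 / (2 * ‖z - p‖) + boundaryCurvature φ p / 4)| ≤ C * ‖z - p‖ := by
  have hDo : IsOpen D := hD.1.1
  have hgrad := hφ.gradient_ne_zero p hφ.mem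
  set e := Complex.exp (θ * Complex.I) with he
  have hen : ‖e‖ = 1 := Complex.norm_exp_ofReal_mul_I θ
  have he0 : e ≠ 0 := Complex.exp_ne_zero _
  obtain ⟨β, δ, C, hδ, hC, hin, hout⟩ := exists_cubicChart_graph_bounds (e := e) hφ
    (norm_pos_iff.2 hgrad) (hφ.eq_zero hDo hp)
    (fun v => by rw [hθ]; exact fderiv_mul_outwardUnitNormal hgrad v)
    (by rw [hθ]; exact realHessian_outwardUnitNormal hgrad)
  set S : Set ℂ := {ζ | p + e * ζ ∈ D} with hS
  have hSo : IsOpen S := hDo.preimage (by fun_prop)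
  have h0S : (0 : ℂ) ∉ S := by
    rw [hDo.frontier_eq] at hp
    simpa [hS] using hp.2
  obtain ⟨G, hG, hGi, hGm, hGj⟩ := exists_inner_map (S := S) hδ hC hin
  obtain ⟨g, hg, hgi, hgm, hgj⟩ := exists_outer_map (S := S) hδ hC h0S hout
  -- Here α = κ/2, so the constant term α/2 is κ/4. The choice of ν and K precedes any metric, hence
  -- is uniform over all of them.
  obtain ⟨ν, hν, K, hK⟩ := exists_pinched_estimate hSo hη hG hGi hGm hGj hg hgi hgm hgj
  have key : ∀ z ∈ pinchedCone θ p η ν, z ∈ D ∧ ∀ m, IsConformallyBounded D z m →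
      |m - (1 / (2 * ‖z - p‖) + boundaryCurvature φ p / 4)| ≤ K * ‖z - p‖ := by
    intro z hz
    rw [pinchedCone, mem_ofPred_eq, Complex.exp_neg, ← he] at hz
    obtain ⟨h1, h2⟩ := hK (e⁻¹ * (z - p)) hz.1 hz.2.1 hz.2.2
    have hzp : p + e * (e⁻¹ * (z - p)) = z := by
      rw [mul_inv_cancel_left₀ he0, add_sub_cancel]
    have hzD : z ∈ D := by
      rw [← hzp]
      exact h1
    refine ⟨hzD, fun m hm => ?_⟩
    have h3 := h2 m (IsConformallyBounded.comp_affine hDo hen h1 (by rwa [hzp]))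
    rwa [norm_mul, norm_inv, hen, inv_one, one_mul, div_div,
      show (2 : ℝ) * 2 = 4 by norm_num] at h3
  obtain ⟨B, hB⟩ := exists_isBergmanKernel hDo
  exact ⟨ν, hν, fun z hz => (key z hz).1, K,
    fun F hF z hz => (key z hz).2 _ (hF.isConformallyBounded hD.1 (key z hz).1),
    B, hB, fun z hz => (key z hz).2 _ (hB.isConformallyBounded hDo (key z hz).1)⟩
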